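/- Let $k\ge 0$, let $\delta_k(x)=|2\sin x|^{2k}$, and put $(f,g)_k=\frac1{2\pi}\int_0^{2\pi}f(x)\overline{g(x)}\,\delta_k(x)\,dx$ and $\|f\|_k=(f,f)_k^{1/2}$. For $j,n\in\mathbb Z$ write $j\triangleleft n$ if either $|j|<|n|$ and $|n|-|j|$ is even, or $|j|=|n|$ and $n<j$. The non-symmetric Heckman–Opdam polynomials $E_n^k$ ($n\in\mathbb Z$) of type $A_1$ are the unique exponential polynomials $E_n^k(z)=e^{nz}+\sum_{j\triangleleft n}c_{n,j}e^{jz}$ such that $(E_n^k(i\,\cdot),e^{ij\,\cdot})_k=0$ for all $j\triangleleft n$. Put $\mathcal E_n^k=E_n^k/\|E_n^k(i\,\cdot)\|_k$, and define the Riesz kernel $$\mathcal R(n,m)=\frac1{2\pi i}\int_0^{2\pi}e^{-ix/2}\,\mathcal E_m^k(ix)\,\mathcal E_n^k(-ix)\,\delta_k(x)\,dx ,\qquad n,m\in\mathbb Z .$$ **Lemma.** For every $k\ge0$ there is a constant $C>0$, depending only on $k$, such that for all $n,m\in\mathbb Z$ with $\frac{|n|}2\le|m|\le\frac{3|n|}2$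 and $|m|\ne|n|$, $$|\mathcal R(n,m+1)-\mathcal R(n,m)|\le\frac{C}{\bigl||m|-|n|\bigr|^2}.$$ -/

import Mathlib

namespace HeckmanOpdam

/-- The weight `δ_k(x) = |2 sin x|^(2k)`. -/
noncomputable def weight (k x : ℝ) : ℝ := |2 * Real.sin x| ^ (2 * k)

/-- The pairing `(f, g)_k = (1 / 2π) ∫_0^{2π} f(x) conj(g(x)) δ_k(x) dx`. -/
noncomputable def innerK (k : ℝ) (f g : ℝ → ℂ) : ℂ :=
  (1 / (2 * Real.pi) : ℂ) *
    ∫ x in (0 : ℝ)..(2 * Real.pi), f x * (starRingEnd ℂ) (g x) * (weight k x : ℂ)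

/-- The norm `‖f‖_k = (f, f)_k^{1/2}`. -/
noncomputable def normK (k : ℝ) (f : ℝ → ℂ) : ℝ := Real.sqrt (innerK k f f).re

/-- The strict partial order `j ◁ n` on `ℤ`. -/
def Precedes (j n : ℤ) : Prop :=
  (|j| < |n| ∧ Even (|n| - |j|)) ∨ (|j| = |n| ∧ n < j)

instance (j n : ℤ) : Decidable (Precedes j n) := by
  unfold Precedes; infer_instance

/-- The finite set of all `j` with `j ◁ n`. -/
noncomputable def lower (n : ℤ) : Finset ℤ := (Finset.Icc (-|n|) |n|).filter (fun j => Precedes j n)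

theorem mem_lower (j n : ℤ) : j ∈ lower n ↔ Precedes j n := by
  simp only [lower, Finset.mem_filter, Finset.mem_Icc, and_iff_right_iff_imp]
  intro h
  have : |j| ≤ |n| := by rcases h with h | h <;> omega
  exact abs_le.mp this

/-- `E` is the non-symmetric Heckman-Opdam polynomial of type `A_1` of index `n`:
(a) `E(z) = e^{nz} + ∑_{j ◁ n} c_j e^{jz}`, and
(b) `(E(i·), e^{ij·})_k = 0` for every `j ◁ n`. -/
def IsHOPoly (k : ℝ) (n : ℤ) (E : ℂ → ℂ) : Prop :=
  (∃ c : ℤ → ℂ, ∀ z : ℂ,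
    E z = Complex.exp (n * z) + ∑ j ∈ lower n, c j * Complex.exp (j * z)) ∧
  ∀ j : ℤ, Precedes j n →
    innerK k (fun x => E (Complex.I * x)) (fun x => Complex.exp (Complex.I * j * x)) = 0

theorem weight_nonneg (k x : ℝ) : 0 ≤ weight k x := Real.rpow_nonneg (abs_nonneg _) _

theorem continuous_weight {k : ℝ} (hk : 0 ≤ k) : Continuous (weight k) := by
  unfold weight
  exact Continuous.rpow_const (by fun_prop) (fun x => Or.inr (by positivity))

theorem innerK_add_left {k : ℝ} (hk : 0 ≤ k) {f g h : ℝ → ℂ} (hf : Continuous f)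
    (hg : Continuous g) (hh : Continuous h) :
    innerK k (fun x => f x + g x) h = innerK k f h + innerK k g h := by
  have hw := continuous_weight hk
  have hc : Continuous fun x => (starRingEnd ℂ) (h x) := Complex.continuous_conj.comp hh
  unfold innerK
  rw [← mul_add, ← intervalIntegral.integral_add]
  · congr 2; ext x; ring
  · exact Continuous.intervalIntegrable (by fun_prop) _ _
  · exact Continuous.intervalIntegrable (by fun_prop) _ _

theorem innerK_sum_left {k : ℝ} (hk : 0 ≤ k) (S : Finset ℤ) (d : ℤ → ℂ) {e : ℤ → ℝ → ℂ}
    {h : ℝ → ℂ} (he : ∀ j, Continuous (e j)) (hh : Continuous h) :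
    innerK k (fun x => ∑ j ∈ S, d j * e j x) h = ∑ j ∈ S, d j * innerK k (e j) h := by
  have hw := continuous_weight hk
  have hc : Continuous fun x => (starRingEnd ℂ) (h x) := Complex.continuous_conj.comp hh
  unfold innerK
  simp only [Finset.sum_mul]
  rw [intervalIntegral.integral_finsetSum]
  · rw [Finset.mul_sum]
    refine Finset.sum_congr rfl fun j _ => ?_
    have : ∀ x, d j * e j x * (starRingEnd ℂ) (h x) * (weight k x : ℂ)
        = d j * (e j x * (starRingEnd ℂ) (h x) * (weight k x : ℂ)) := fun x => by ring
    simp only [this, intervalIntegral.integral_const_mul]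
    ring
  · intro j _
    have := he j
    exact Continuous.intervalIntegrable (by fun_prop) _ _

theorem innerK_conj (k : ℝ) (f g : ℝ → ℂ) :
    innerK k g f = (starRingEnd ℂ) (innerK k f g) := by
  have hpi : (0 : ℝ) ≤ 2 * Real.pi := by positivity
  unfold innerK
  rw [map_mul, intervalIntegral.integral_of_le hpi, intervalIntegral.integral_of_le hpi,
    ← integral_conj]
  congr 1
  · have h : (1 / (2 * Real.pi) : ℂ) = ((1 / (2 * Real.pi) : ℝ) : ℂ) := by push_cast; rfl
    rw [h, Complex.conj_ofReal]
  · congr 1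
    ext x
    rw [map_mul, map_mul, Complex.conj_conj, Complex.conj_ofReal]
    ring

theorem eq_zero_of_innerK_self {k : ℝ} (hk : 0 ≤ k) {f : ℝ → ℂ} (hf : Continuous f)
    (h : innerK k f f = 0) :
    ∀ᵐ x, x ∈ Set.uIoc (0 : ℝ) (2 * Real.pi) → f x = 0 := by
  have hw := continuous_weight hk
  have hpi := Real.pi_pos
  have h1 : ∀ x, f x * (starRingEnd ℂ) (f x) * (weight k x : ℂ)
      = ((‖f x‖ ^ 2 * weight k x : ℝ) : ℂ) := fun x => by
    rw [Complex.mul_conj, Complex.normSq_eq_norm_sq]; push_cast; ring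
  unfold innerK at h
  simp only [h1, intervalIntegral.integral_ofReal] at h
  have h2 : ∫ x in (0 : ℝ)..(2 * Real.pi), ‖f x‖ ^ 2 * weight k x = 0 := by
    rcases mul_eq_zero.mp h with h | h
    · exfalso
      have : (1 / (2 * Real.pi) : ℝ) ≠ 0 := by positivity
      exact this (by exact_mod_cast h)
    · exact_mod_cast h
  have hc : Continuous fun x => ‖f x‖ ^ 2 * weight k x := by fun_prop
  rw [intervalIntegral.integral_eq_zero_iff_of_le_of_nonneg_ae (by positivity)
    (Filter.Eventually.of_forall fun x => by
      have := weight_nonneg k x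
      simp only [Pi.zero_apply]; positivity) (hc.intervalIntegrable _ _)] at h2
  rw [Filter.EventuallyEq, MeasureTheory.ae_restrict_iff' measurableSet_Ioc] at h2
  have h3 : ∀ᵐ x : ℝ, x ∉ ({Real.pi, 2 * Real.pi} : Set ℝ) :=
    Set.Countable.ae_notMem (Set.toFinite _).countable _
  filter_upwards [h2, h3] with x hx hx3 hxm
  rw [Set.uIoc_of_le (by positivity)] at hxm
  have h4 := hx hxm
  simp only [Set.mem_insert_iff, Set.mem_singleton_iff, not_or] at hx3
  have hs : Real.sin x ≠ 0 := by
    rcases lt_or_gt_of_ne hx3.1 with hlt | hgt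
    · exact (Real.sin_pos_of_pos_of_lt_pi hxm.1 hlt).ne'
    · have h5 : 0 < Real.sin (x - Real.pi) :=
        Real.sin_pos_of_pos_of_lt_pi (by linarith)
          (by have := lt_of_le_of_ne hxm.2 hx3.2; linarith)
      rw [Real.sin_sub_pi] at h5
      linarith
  have hwx : weight k x ≠ 0 := by
    unfold weight
    exact (Real.rpow_pos_of_pos (abs_pos.mpr (mul_ne_zero two_ne_zero hs)) _).ne'
  simpa [hwx] using h4

theorem integral_exp_int (p : ℤ) (hp : p ≠ 0) :
    ∫ x in (0 : ℝ)..(2 * Real.pi), Complex.exp (Complex.I * p * x) = 0 := by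
  rw [integral_exp_mul_complex (by simpa using hp)]
  have : Complex.I * p * ((2 * Real.pi : ℝ) : ℂ) = p * (2 * Real.pi * Complex.I) := by
    push_cast; ring
  rw [this, Complex.exp_int_mul_two_pi_mul_I]
  simp

theorem coeff_eq_zero {k : ℝ} (hk : 0 ≤ k) (S : Finset ℤ) (d : ℤ → ℂ)
    (h : ∀ l ∈ S, innerK k (fun x => ∑ j ∈ S, d j * Complex.exp (Complex.I * j * x))
      (fun x => Complex.exp (Complex.I * l * x)) = 0) : ∀ l ∈ S, d l = 0 := by
  have hcont : ∀ j : ℤ, Continuous fun x : ℝ => Complex.exp (Complex.I * j * x) :=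
    fun j => by fun_prop
  set f : ℝ → ℂ := fun x => ∑ j ∈ S, d j * Complex.exp (Complex.I * j * x) with hf
  have hfc : Continuous f := by fun_prop
  have h0 : innerK k f f = 0 := by
    have := innerK_sum_left hk S d hcont hfc
    rw [← hf] at this
    rw [this]
    refine Finset.sum_eq_zero fun j hj => ?_
    rw [innerK_conj, h j hj]; simp
  have hae := eq_zero_of_innerK_self hk hfc h0
  intro l hl
  have h1 : ∫ x in (0 : ℝ)..(2 * Real.pi), f x * Complex.exp (-(Complex.I * l * x)) = 0 := by
    rw [intervalIntegral.integral_congr_ae (g := fun _ => 0)]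
    · simp
    · filter_upwards [hae] with x hx hxm
      simp [hx hxm]
  have h2 : ∀ x : ℝ, f x * Complex.exp (-(Complex.I * l * x))
      = ∑ j ∈ S, d j * Complex.exp (Complex.I * (j - l : ℤ) * x) := fun x => by
    simp only [hf, Finset.sum_mul, mul_assoc, ← Complex.exp_add]
    refine Finset.sum_congr rfl fun j _ => ?_
    push_cast
    congr 2; ring
  simp only [h2] at h1
  rw [intervalIntegral.integral_finsetSum
    (fun j _ => Continuous.intervalIntegrable (by fun_prop) _ _)] at h1
  simp only [intervalIntegral.integral_const_mul] at h1
  rw [Finset.sum_eq_single_of_mem l hl] at h1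
  · have hpi := Real.pi_ne_zero
    simpa [hpi] using h1
  · intro j _ hj
    rw [integral_exp_int _ (sub_ne_zero.mpr hj), mul_zero]

theorem existsUnique_isHOPoly {k : ℝ} (hk : 0 ≤ k) (n : ℤ) : ∃! E : ℂ → ℂ, IsHOPoly k n E := by
  have hcont : ∀ j : ℤ, Continuous fun x : ℝ => Complex.exp (Complex.I * j * x) :=
    fun j => by fun_prop
  have hexp : ∀ (j : ℤ) (x : ℝ), Complex.exp (j * (Complex.I * x))
      = Complex.exp (Complex.I * j * x) := fun j x => by congr 1; ring
  have key : ∀ (c : ℤ → ℂ) (l : ℤ),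
      innerK k (fun x : ℝ => Complex.exp (n * (Complex.I * x))
          + ∑ j ∈ lower n, c j * Complex.exp (j * (Complex.I * x)))
        (fun x => Complex.exp (Complex.I * l * x))
      = innerK k (fun x => Complex.exp (Complex.I * n * x))
          (fun x => Complex.exp (Complex.I * l * x))
        + innerK k (fun x => ∑ j ∈ lower n, c j * Complex.exp (Complex.I * j * x))
          (fun x => Complex.exp (Complex.I * l * x)) := fun c l => by
    simp only [hexp]
    exact innerK_add_left hk (hcont n) (by fun_prop) (hcont l)
  -- existence: the Gram matrix of the exponentials is injective, hence surjective
  let G : (lower n → ℂ) →ₗ[ℂ] (lower n → ℂ) :=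
    { toFun := fun c l => ∑ j, c j * innerK k (fun x => Complex.exp (Complex.I * (j : ℤ) * x))
        (fun x => Complex.exp (Complex.I * (l : ℤ) * x))
      map_add' := fun a b => by
        ext l; simp [add_mul, Finset.sum_add_distrib]
      map_smul' := fun r a => by
        ext l; simp [Finset.mul_sum, mul_assoc] }
  let ext0 : (lower n → ℂ) → ℤ → ℂ := fun c j => if hj : j ∈ lower n then c ⟨j, hj⟩ else 0
  have hG : ∀ (c : lower n → ℂ) (l : lower n),
      innerK k (fun x => ∑ j ∈ lower n, ext0 c j * Complex.exp (Complex.I * j * x))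
        (fun x => Complex.exp (Complex.I * (l : ℤ) * x)) = G c l := fun c l => by
    rw [innerK_sum_left hk _ _ hcont (hcont l), ← Finset.sum_attach]
    refine Finset.sum_congr rfl fun j _ => ?_
    simp [ext0]
  have hinj : Function.Injective G := by
    rw [injective_iff_map_eq_zero]
    intro c hc
    have h1 := coeff_eq_zero hk (lower n) (ext0 c) (fun l hl => by
      rw [hG c ⟨l, hl⟩, hc]; rfl)
    ext j
    have := h1 j j.2
    simpa [ext0] using this
  have hsurj : Function.Surjective G := LinearMap.injective_iff_surjective.mp hinj
  obtain ⟨c, hc⟩ := hsurj fun l =>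
    -innerK k (fun x => Complex.exp (Complex.I * n * x))
      (fun x => Complex.exp (Complex.I * (l : ℤ) * x))
  refine ⟨fun z => Complex.exp (n * z) + ∑ j ∈ lower n, ext0 c j * Complex.exp (j * z),
    ⟨⟨ext0 c, fun z => rfl⟩, fun l hl => ?_⟩, ?_⟩
  · have hl' := (mem_lower l n).mpr hl
    rw [key, hG c ⟨l, hl'⟩, hc]
    simp
  · rintro E ⟨⟨b, hb⟩, hE⟩
    have hd : ∀ l ∈ lower n, b l - ext0 c l = 0 := by
      refine coeff_eq_zero hk (lower n) (fun j => b j - ext0 c j) fun l hl => ?_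
      have h1 := hE l ((mem_lower l n).mp hl)
      simp only [hb] at h1
      rw [key, innerK_sum_left hk _ _ hcont (hcont l)] at h1
      have h2 := hG c ⟨l, hl⟩
      rw [hc, innerK_sum_left hk _ _ hcont (hcont l)] at h2
      rw [innerK_sum_left hk _ _ hcont (hcont l)]
      simp only [sub_mul, Finset.sum_sub_distrib]
      rw [h2, sub_neg_eq_add, add_comm]
      exact h1
    ext z
    rw [hb]
    congr 1
    exact Finset.sum_congr rfl fun j hj => by rw [sub_eq_zero.mp (hd j hj)]

/-- The non-symmetric Heckman-Opdam polynomial `E_n^k`, as a function on `ℂ`: for `k ≥ 0` it is the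
unique function with the properties (a) and (b) of `IsHOPoly`. -/
noncomputable def hoPoly (k : ℝ) (n : ℤ) : ℂ → ℂ :=
  Classical.epsilon (IsHOPoly k n)

theorem isHOPoly_hoPoly {k : ℝ} (hk : 0 ≤ k) (n : ℤ) : IsHOPoly k n (hoPoly k n) :=
  Classical.epsilon_spec (existsUnique_isHOPoly hk n).exists

/-- The normalized polynomial `𝓔_n^k = E_n^k / ‖E_n^k‖_k`, the norm being that of
`x ↦ E_n^k(ix)`. -/
noncomputable def hoNormalized (k : ℝ) (n : ℤ) (z : ℂ) : ℂ :=
  hoPoly k n z / (normK k (fun x => hoPoly k n (Complex.I * x)) : ℂ)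

/-- The Riesz kernel
`R(n, m) = (1 / 2πi) ∫_0^{2π} e^{-ix/2} 𝓔_m^k(ix) 𝓔_n^k(-ix) δ_k(x) dx`. -/
noncomputable def rieszKernel (k : ℝ) (n m : ℤ) : ℂ :=
  (1 / (2 * Real.pi * Complex.I) : ℂ) *
    ∫ x in (0 : ℝ)..(2 * Real.pi),
      Complex.exp (-(Complex.I * x / 2)) * hoNormalized k m (Complex.I * x) *
        hoNormalized k n (-(Complex.I * x)) * (weight k x : ℂ)

end HeckmanOpdam

namespace HeckmanOpdam

/-! Write `d = ||m| - |n||`. On the imaginary axis, `𝓔_n` is an eigenfunction of the Cherednik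
operator, with eigenvalue `λ_n = n + k` for `n ≥ 1` and `λ_n = n - k` for `n ≤ 0`. For `P = 𝓔_m ·
conj 𝓔_n · δ_k` this gives `P' = i(λ_m - λ_n) P` plus a term with the singular density `k δ_k /
sin`. That term drops out when `P'` is integrated against a function symmetric about `π`
(`CherednikEigen.integral_by_parts_of_symm`). All decay comes from such integrations by parts.

Let `R(m)` be the Riesz integral with `n` fixed. The proof rests on two facts.

Decay: `R(m) = O(1 / (1 + d))` (`exists_rieszInt_bound`). Integrating by parts against `e^{-ix/2}`
bounds `(λ_m - λ_n - 1/2) R(m)` by a constant plus `k` times the modulus of the integral of `𝓔_{1-m}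
· conj 𝓔_n · δ_k / sin(x/2)` (`rieszInt_eq`). The cosecant is again symmetric. After regularization
at scale `1/N`, with `N` of the order of `|n| + |m|`, a second integration by parts gains `|λ_{1-m}
- λ_n| = |1 - λ_m - λ_n|` at the cost of `N`. One of the two spectral gaps is at least of order `N`
and the other at least of order `d`, whatever the signs of `n` and `m` (`eigenvalue_gap`). This
needs `|𝓔_n|² δ_k` bounded uniformly in `n`, and `|𝓔_n|² = O((|n| + 1)^(2k))` near the zeros of the
weight (`exists_hoFun_bounds`); both come from an energy argument for the first-order system
satisfied by `Re 𝓔_n` and `Im 𝓔_n`.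

Difference: multiplication by `e^{ix}` sends `𝓔_m` to `γ 𝓔_{m+1} ∓ β 𝓔_{1-m}` with `β = k / (|m| +
k)` and `γ² = 1 - β²`. Since `e^{ix/2} - e^{-ix/2} = 2i sin(x/2)`, the difference `R(m+1) - R(m)`
equals `(1 - γ) R(m+1) ± β R(1-m) + 2i S(m)`, where `S` has `sin(x/2)` in place of `e^{-ix/2}`. In
the stated range `d ≤ |m|`, so `1 - γ ≤ β² = O(1/d²)` and `β R(1-m) = O(1/d²)`. One more symmetric
integration by parts gives `|S(m)| ≤ |R(m)| / d = O(1/d²)` (`norm_sinHalfInt_mul`). -/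

/-! ### The weight and its singular density -/

theorem weight_two_pi_sub (k x : ℝ) : weight k (2 * Real.pi - x) = weight k x := by
  simp [weight, Real.sin_two_pi_sub]

theorem weight_le {k : ℝ} (hk : 0 ≤ k) (x : ℝ) : weight k x ≤ 2 ^ (2 * k) := by
  unfold weight
  refine Real.rpow_le_rpow (abs_nonneg _) ?_ (by positivity)
  rw [abs_mul, abs_two]
  linarith [Real.abs_sin_le_one x]

theorem hasDerivAt_weight (k : ℝ) {x : ℝ} (hx : Real.sin x ≠ 0) :
    HasDerivAt (weight k) (2 * k * (Real.cos x / Real.sin x) * weight k x) x := by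
  have h2 : (2 * Real.sin x) ≠ 0 := mul_ne_zero two_ne_zero hx
  have h1 : HasDerivAt (fun y => 2 * Real.sin y) (2 * Real.cos x) x :=
    (Real.hasDerivAt_sin x).const_mul 2
  have h3 := ((hasDerivAt_abs h2).comp x h1).rpow_const (p := 2 * k)
    (Or.inl (abs_ne_zero.mpr h2))
  refine h3.congr_deriv ?_
  simp only [Function.comp_apply]
  rw [Real.rpow_sub_one (abs_ne_zero.mpr h2), weight]
  rcases lt_or_gt_of_ne h2 with h | h
  · rw [sign_neg h, abs_of_neg h]
    field_simp
    simp
  · rw [sign_pos h, abs_of_pos h]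
    field_simp
    simp

/-- The singular density `k δ_k / sin` is integrable over a period. -/
theorem intervalIntegrable_weight_div_sin {k : ℝ} (hk : 0 ≤ k) :
    IntervalIntegrable (fun x => k * weight k x / Real.sin x) MeasureTheory.volume
      0 (2 * Real.pi) := by
  have hpi := Real.pi_pos
  have h1 : IntervalIntegrable (fun x => k * weight k x / Real.sin x) MeasureTheory.volume
      0 Real.pi := by
    -- On `(0, π)` the derivative of `cos · δ_k` is `2k δ_k / sin - (2k + 1) sin · δ_k`. The linear
    -- term makes the derivative nonnegative, and a continuous function with nonnegative derivative
    -- has an integrable derivative.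
    set g : ℝ → ℝ := fun x => Real.cos x * weight k x + (2 * k + 1) * 2 ^ (2 * k) * x with hg
    set g' : ℝ → ℝ := fun x => -Real.sin x * weight k x
      + Real.cos x * (2 * k * (Real.cos x / Real.sin x) * weight k x)
      + (2 * k + 1) * 2 ^ (2 * k) with hg'
    have hw := continuous_weight hk
    have hgc : Continuous g := by fun_prop
    have hgd : ∀ x ∈ Set.Ioo 0 Real.pi, HasDerivAt g (g' x) x := fun x hx => by
      have hs := Real.sin_pos_of_pos_of_lt_pi hx.1 hx.2
      have := ((Real.hasDerivAt_cos x).mul (hasDerivAt_weight k hs.ne')).add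
        ((hasDerivAt_id x).const_mul ((2 * k + 1) * 2 ^ (2 * k)))
      exact this.congr_deriv (by simp [hg'])
    have heq : ∀ x ∈ Set.Ioo 0 Real.pi, g' x = 2 * (k * weight k x / Real.sin x)
        + (2 * k + 1) * (2 ^ (2 * k) - Real.sin x * weight k x) := fun x hx => by
      have hs := Real.sin_pos_of_pos_of_lt_pi hx.1 hx.2
      have : Real.cos x ^ 2 = 1 - Real.sin x ^ 2 := by linarith [Real.sin_sq_add_cos_sq x]
      simp only [hg']
      field_simp
      rw [this]
      ring
    have hpos : ∀ x ∈ Set.Ioo 0 Real.pi, 0 ≤ g' x := fun x hx => by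
      rw [heq x hx]
      have hs := Real.sin_pos_of_pos_of_lt_pi hx.1 hx.2
      have h3 := weight_nonneg k x
      have h4 : Real.sin x * weight k x ≤ 1 * 2 ^ (2 * k) :=
        mul_le_mul (Real.sin_le_one x) (weight_le hk x) h3 zero_le_one
      have : 0 ≤ 2 ^ (2 * k) - Real.sin x * weight k x := by linarith
      positivity
    have hint : IntervalIntegrable g' MeasureTheory.volume 0 Real.pi := by
      rw [intervalIntegrable_iff_integrableOn_Ioc_of_le hpi.le]
      exact intervalIntegral.integrableOn_deriv_of_nonneg hgc.continuousOn hgd hpos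
    have h5 : IntervalIntegrable
        (fun x => (2 * k + 1) * (2 ^ (2 * k) - Real.sin x * weight k x))
        MeasureTheory.volume 0 Real.pi := Continuous.intervalIntegrable (by fun_prop) _ _
    have h6 := (hint.sub h5).div_const 2
    rw [intervalIntegrable_iff_integrableOn_Ioo_of_le hpi.le] at h6 ⊢
    refine h6.congr_fun (fun x hx => ?_) measurableSet_Ioo
    simp only [heq x hx]
    ring
  have h2 : IntervalIntegrable (fun x => k * weight k x / Real.sin x) MeasureTheory.volume
      Real.pi (2 * Real.pi) := by
    have := (h1.comp_sub_left (2 * Real.pi)).symm.neg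
    have h3 : 2 * Real.pi - Real.pi = Real.pi := by ring
    simpa [weight_two_pi_sub, Real.sin_two_pi_sub, h3, div_neg, Pi.neg_def] using this
  exact h1.trans h2

/-! ### Cherednik eigenfunctions on the circle -/

/-- Eigenfunctions of the Cherednik operator of type `A_1` on the unit circle, with the symmetry
`conj a(x) = a(-x)` of exponential polynomials with real coefficients. -/
structure CherednikEigen (k lam : ℝ) (a : ℝ → ℂ) : Prop where
  cont : Continuous a
  conj : ∀ x, (starRingEnd ℂ) (a x) = a (-x)
  per : ∀ x, a (x + 2 * Real.pi) = a x
  deriv : ∀ x, Real.sin x ≠ 0 → HasDerivAt a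
    (Complex.I * lam * a x + Complex.I * k * (starRingEnd ℂ) (a x)
      - k * (Real.cos x / Real.sin x : ℝ) * (a x - (starRingEnd ℂ) (a x))) x

namespace CherednikEigen

variable {k lam mu : ℝ} {a b : ℝ → ℂ}

theorem two_pi_sub (ha : CherednikEigen k lam a) (x : ℝ) :
    a (2 * Real.pi - x) = (starRingEnd ℂ) (a x) := by
  rw [ha.conj, ← ha.per (-x)]; congr 1; ring

theorem cont_conj (ha : CherednikEigen k lam a) :
    Continuous fun x => (starRingEnd ℂ) (a x) := Complex.continuous_conj.comp ha.cont

theorem smul (ha : CherednikEigen k lam a) (r : ℝ) : CherednikEigen k lam fun x => r * a x where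
  cont := continuous_const.mul ha.cont
  conj x := by rw [map_mul, Complex.conj_ofReal, ha.conj]
  per x := by rw [ha.per]
  deriv x hx := by
    refine ((ha.deriv x hx).const_mul (r : ℂ)).congr_deriv ?_
    simp only [map_mul, Complex.conj_ofReal]
    ring

theorem exp_I_mul_eq (x : ℝ) : Complex.exp (Complex.I * x) = Real.cos x + Complex.I * Real.sin x := by
  rw [mul_comm, Complex.exp_mul_I]; push_cast; ring

theorem hasDerivAt_exp (x : ℝ) :
    HasDerivAt (fun y : ℝ => Complex.exp (Complex.I * y))
      (Complex.I * Complex.exp (Complex.I * x)) x := by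
  have h : HasDerivAt (fun y : ℝ => Complex.I * (y : ℂ)) (Complex.I * 1) x :=
    (Complex.ofRealCLM.hasDerivAt (x := x)).const_mul Complex.I
  refine h.cexp.congr_deriv ?_
  ring

theorem hasDerivAt_conj {x : ℝ} {a' : ℂ} (h : HasDerivAt a a' x) :
    HasDerivAt (fun y => (starRingEnd ℂ) (a y)) ((starRingEnd ℂ) a') x :=
  h.star

theorem conj_exp (x : ℝ) :
    (starRingEnd ℂ) (Complex.exp (Complex.I * x)) = Complex.exp (-(Complex.I * x)) := by
  rw [← Complex.exp_conj]; simp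

/-- Multiplication by `e^{ix}` composed with conjugation maps the eigenvalue `λ` to `1 - λ`. -/
theorem reflect (ha : CherednikEigen k lam a) :
    CherednikEigen k (1 - lam) fun x => Complex.exp (Complex.I * x) * (starRingEnd ℂ) (a x) where
  cont := by have := ha.cont_conj; fun_prop
  conj x := by
    rw [map_mul, conj_exp, ha.conj, ha.conj, neg_neg, Complex.ofReal_neg, mul_neg]
  per x := by
    rw [ha.per]
    congr 1
    rw [Complex.exp_eq_exp_iff_exists_int]
    exact ⟨1, by push_cast; ring⟩
  deriv x hx := by
    refine ((hasDerivAt_exp x).mul (hasDerivAt_conj (ha.deriv x hx))).congr_deriv ?_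
    have hx' : (Real.sin x : ℂ) ≠ 0 := by exact_mod_cast hx
    simp only [map_mul, map_add, map_sub, Complex.conj_conj, Complex.conj_I, Complex.conj_ofReal,
      exp_I_mul_eq, Complex.ofReal_sub, Complex.ofReal_one, Complex.ofReal_div, map_div₀]
    field_simp
    ring

end CherednikEigen
-- Integration by parts for products of eigenfunctions
namespace CherednikEigen

variable {k lam mu : ℝ} {a b : ℝ → ℂ}

/-- The term `2k cot` from the weight cancels the diagonal part of the two cotangent terms. What
remains is `k (cot x + i) conj a conj b` and its counterpart with `a b`, and `cot x + i = e^{ix} /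
sin x`. -/
theorem hasDerivAt_mul_conj_mul_weight (ha : CherednikEigen k lam a) (hb : CherednikEigen k mu b)
    {x : ℝ} (hx : Real.sin x ≠ 0) :
    HasDerivAt (fun y => a y * (starRingEnd ℂ) (b y) * (weight k y : ℂ))
      (Complex.I * (lam - mu) * (a x * (starRingEnd ℂ) (b x) * (weight k x : ℂ))
        + (k * weight k x / Real.sin x : ℝ)
          * (Complex.exp (Complex.I * x) * (starRingEnd ℂ) (a x) * (starRingEnd ℂ) (b x)
            + (starRingEnd ℂ)
              (Complex.exp (Complex.I * x) * (starRingEnd ℂ) (a x) * (starRingEnd ℂ) (b x)))) x := by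
  refine (((ha.deriv x hx).mul (hasDerivAt_conj (hb.deriv x hx))).mul
    (hasDerivAt_weight k hx).ofReal_comp).congr_deriv ?_
  have hx' : (Real.sin x : ℂ) ≠ 0 := by exact_mod_cast hx
  have he : (starRingEnd ℂ) (Complex.exp (Complex.I * x))
      = Real.cos x - Complex.I * Real.sin x := by
    simp only [exp_I_mul_eq, map_add, map_mul, Complex.conj_I, Complex.conj_ofReal]
    ring
  simp only [map_mul, map_add, map_sub, Complex.conj_conj, Complex.conj_I, Complex.conj_ofReal, he]
  simp only [exp_I_mul_eq, Complex.ofReal_div, Complex.ofReal_mul,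
    Complex.ofReal_ofNat, Pi.mul_apply]
  field_simp
  ring

/-- Integration by parts against a product of two eigenfunctions. -/
theorem integral_by_parts (hk : 0 ≤ k) (ha : CherednikEigen k lam a) (hb : CherednikEigen k mu b)
    {φ φ' : ℝ → ℂ} (hφ : ContinuousOn φ (Set.Icc 0 (2 * Real.pi)))
    (hd : ∀ x ∈ Set.Ioo 0 (2 * Real.pi), HasDerivAt φ (φ' x) x)
    (hφ' : ContinuousOn φ' (Set.Icc 0 (2 * Real.pi))) :
    (φ (2 * Real.pi) - φ 0) * (a 0 * (starRingEnd ℂ) (b 0) * (weight k 0 : ℂ))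
      = (∫ x in (0 : ℝ)..(2 * Real.pi), φ' x * (a x * (starRingEnd ℂ) (b x) * (weight k x : ℂ)))
        + Complex.I * (lam - mu) *
          (∫ x in (0 : ℝ)..(2 * Real.pi), φ x * (a x * (starRingEnd ℂ) (b x) * (weight k x : ℂ)))
        + ∫ x in (0 : ℝ)..(2 * Real.pi), (φ x - φ (2 * Real.pi - x))
          * ((k * weight k x / Real.sin x : ℝ)
            * (Complex.exp (Complex.I * x) * (starRingEnd ℂ) (a x) * (starRingEnd ℂ) (b x))) := by
  have hpi : (0 : ℝ) ≤ 2 * Real.pi := by positivity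
  set P : ℝ → ℂ := fun x => a x * (starRingEnd ℂ) (b x) * (weight k x : ℂ) with hP
  set c : ℝ → ℂ := fun x =>
    Complex.exp (Complex.I * x) * (starRingEnd ℂ) (a x) * (starRingEnd ℂ) (b x) with hc
  set v : ℝ → ℂ := fun x => ((k * weight k x / Real.sin x : ℝ) : ℂ) with hv
  have hw := continuous_weight hk
  have hac := ha.cont
  have hac' := ha.cont_conj
  have hbc' := hb.cont_conj
  have hPc : Continuous P := by fun_prop
  have hcc : Continuous c := by fun_prop
  have hccc : Continuous fun x => (starRingEnd ℂ) (c x) := Complex.continuous_conj.comp hcc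
  have hIcc : Set.uIcc 0 (2 * Real.pi) = Set.Icc 0 (2 * Real.pi) := Set.uIcc_of_le hpi
  have hvi : IntervalIntegrable v MeasureTheory.volume 0 (2 * Real.pi) :=
    by
    have := intervalIntegrable_weight_div_sin hk
    exact ⟨this.1.ofReal, this.2.ofReal⟩
  have i1 : IntervalIntegrable (fun x => φ' x * P x) MeasureTheory.volume 0 (2 * Real.pi) :=
    ContinuousOn.intervalIntegrable (by rw [hIcc]; exact hφ'.mul hPc.continuousOn)
  have i2 : IntervalIntegrable (fun x => φ x * P x) MeasureTheory.volume 0 (2 * Real.pi) :=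
    ContinuousOn.intervalIntegrable (by rw [hIcc]; exact hφ.mul hPc.continuousOn)
  have i3 : IntervalIntegrable (fun x => v x * (φ x * c x)) MeasureTheory.volume
      0 (2 * Real.pi) :=
    hvi.mul_continuousOn (by rw [hIcc]; exact hφ.mul hcc.continuousOn)
  have i4 : IntervalIntegrable (fun x => v x * (φ x * (starRingEnd ℂ) (c x)))
      MeasureTheory.volume 0 (2 * Real.pi) :=
    hvi.mul_continuousOn (by rw [hIcc]; exact hφ.mul hccc.continuousOn)
  have hsin : ∀ x ∈ Set.Ioo 0 (2 * Real.pi) \ {Real.pi}, Real.sin x ≠ 0 := by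
    rintro x ⟨⟨h0, h1⟩, h2⟩
    rcases lt_or_gt_of_ne h2 with h | h
    · exact (Real.sin_pos_of_pos_of_lt_pi h0 h).ne'
    · have : 0 < Real.sin (x - Real.pi) :=
        Real.sin_pos_of_pos_of_lt_pi (by linarith) (by linarith)
      rw [Real.sin_sub_pi] at this
      linarith
  have key := MeasureTheory.integral_eq_of_hasDerivAt_off_countable_of_le (fun x => φ x * P x)
    (fun x => φ' x * P x + (Complex.I * (lam - mu) * (φ x * P x)
      + (v x * (φ x * c x) + v x * (φ x * (starRingEnd ℂ) (c x)))))
    hpi (Set.countable_singleton Real.pi) (hφ.mul hPc.continuousOn)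
    (fun x hx => ((hd x hx.1).mul
      (hasDerivAt_mul_conj_mul_weight ha hb (hsin x hx))).congr_deriv (by
        simp only [hP, hc, hv]; ring))
    (i1.add ((i2.const_mul _).add (i3.add i4)))
  rw [intervalIntegral.integral_add i1 ((i2.const_mul _).add (i3.add i4)),
    intervalIntegral.integral_add (i2.const_mul _) (i3.add i4),
    intervalIntegral.integral_add i3 i4, intervalIntegral.integral_const_mul] at key
  have hP2 : P (2 * Real.pi) = P 0 := by
    have h1 := ha.per 0
    have h2 := hb.per 0
    have h3 := weight_two_pi_sub k 0
    simp only [zero_add, sub_zero] at h1 h2 h3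
    simp only [hP, h1, h2, h3]
  -- Under `x ↦ 2π - x` the density `v` is odd and `conj c` becomes `c`. The integral with `conj c`
  -- therefore folds onto the one with `c`, leaving the factor `φ(x) - φ(2π - x)`.
  have hrefl : ∀ x, v (2 * Real.pi - x) = -v x := fun x => by
    simp only [hv, weight_two_pi_sub, Real.sin_two_pi_sub, div_neg, Complex.ofReal_neg]
  have hcrefl : ∀ x : ℝ, (starRingEnd ℂ) (c (2 * Real.pi - x)) = c x := fun x => by
    have he : Complex.exp (Complex.I * (2 * Real.pi - x : ℝ))
        = (starRingEnd ℂ) (Complex.exp (Complex.I * x)) := by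
      rw [conj_exp, Complex.exp_eq_exp_iff_exists_int]
      exact ⟨1, by push_cast; ring⟩
    simp only [hc, he, ha.two_pi_sub, hb.two_pi_sub, map_mul, Complex.conj_conj]
  have i5 : IntervalIntegrable (fun x => φ (2 * Real.pi - x) * (v x * c x)) MeasureTheory.volume
      0 (2 * Real.pi) := by
    have := (i4.comp_sub_left (2 * Real.pi)).symm.neg
    simp only [sub_zero, sub_self] at this
    refine this.congr (fun x _ => ?_)
    simp only [Pi.neg_apply, hrefl, hcrefl]
    ring
  have hsub : ∫ x in (0 : ℝ)..(2 * Real.pi), v x * (φ x * (starRingEnd ℂ) (c x))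
      = -∫ x in (0 : ℝ)..(2 * Real.pi), φ (2 * Real.pi - x) * (v x * c x) := by
    have h1 := intervalIntegral.integral_comp_sub_left (a := 0) (b := 2 * Real.pi)
      (fun x => v x * (φ x * (starRingEnd ℂ) (c x))) (2 * Real.pi)
    simp only [sub_zero, sub_self] at h1
    rw [← h1, ← intervalIntegral.integral_neg]
    refine intervalIntegral.integral_congr fun x _ => ?_
    simp only [hrefl, hcrefl]
    ring
  have i3' : IntervalIntegrable (fun x => φ x * (v x * c x)) MeasureTheory.volume
      0 (2 * Real.pi) := i3.congr fun x _ => by ring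
  have hlast : ∫ x in (0 : ℝ)..(2 * Real.pi), (φ x - φ (2 * Real.pi - x)) * (v x * c x)
      = (∫ x in (0 : ℝ)..(2 * Real.pi), v x * (φ x * c x))
        + ∫ x in (0 : ℝ)..(2 * Real.pi), v x * (φ x * (starRingEnd ℂ) (c x)) := by
    have h1 : ∫ x in (0 : ℝ)..(2 * Real.pi), v x * (φ x * c x)
        = ∫ x in (0 : ℝ)..(2 * Real.pi), φ x * (v x * c x) :=
      intervalIntegral.integral_congr fun x _ => by ring
    rw [hsub, ← sub_eq_add_neg, h1, ← intervalIntegral.integral_sub i3' i5]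
    exact intervalIntegral.integral_congr fun x _ => by ring
  rw [hlast, sub_mul]
  rw [hP2] at key
  change φ (2 * Real.pi) * P 0 - φ 0 * P 0 = _
  rw [← key]
  ring

theorem integral_by_parts_of_symm (hk : 0 ≤ k) (ha : CherednikEigen k lam a)
    (hb : CherednikEigen k mu b)
    {φ φ' : ℝ → ℂ} (hφ : ContinuousOn φ (Set.Icc 0 (2 * Real.pi)))
    (hd : ∀ x ∈ Set.Ioo 0 (2 * Real.pi), HasDerivAt φ (φ' x) x)
    (hφ' : ContinuousOn φ' (Set.Icc 0 (2 * Real.pi)))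
    (hs : ∀ x, φ (2 * Real.pi - x) = φ x) :
    (∫ x in (0 : ℝ)..(2 * Real.pi), φ' x * (a x * (starRingEnd ℂ) (b x) * (weight k x : ℂ)))
        + Complex.I * (lam - mu) *
          (∫ x in (0 : ℝ)..(2 * Real.pi), φ x * (a x * (starRingEnd ℂ) (b x) * (weight k x : ℂ)))
        = 0 := by
  have h := integral_by_parts hk ha hb hφ hd hφ'
  have h0 := hs 0
  rw [sub_zero] at h0
  simp only [hs, sub_self, zero_mul, h0, intervalIntegral.integral_zero, add_zero] at h
  exact h.symm

/-- The symmetric integration by parts with `φ = 1`: eigenfunctions of distinct eigenvalues are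
orthogonal. -/
theorem innerK_eq_zero (hk : 0 ≤ k) (ha : CherednikEigen k lam a) (hb : CherednikEigen k mu b)
    (hne : lam ≠ mu) : innerK k a b = 0 := by
  have h := integral_by_parts_of_symm hk ha hb (φ := fun _ => 1) (φ' := fun _ => 0)
    continuousOn_const (fun x _ => hasDerivAt_const x 1) continuousOn_const (fun _ => rfl)
  have h2 : (lam : ℂ) - mu ≠ 0 := sub_ne_zero.mpr (by exact_mod_cast hne)
  simp only [zero_mul, intervalIntegral.integral_zero, zero_add, one_mul, mul_eq_zero,
    Complex.I_ne_zero, h2, false_or] at h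
  rw [innerK, h, mul_zero]

end CherednikEigen
-- Explicit polynomials from the recurrence
/-- The recurrence coefficient `k / (n + k)`. -/
noncomputable def recCoeff (k : ℝ) (n : ℕ) : ℝ := k / (n + k)

/-- The polynomials of index `l + 1`, defined by their recurrence. -/
noncomputable def posPoly (k : ℝ) : ℕ → ℂ → ℂ
  | 0 => Complex.exp
  | l + 1 => fun z => Complex.exp z * (posPoly k l z + recCoeff k (l + 1) * posPoly k l (-z))

/-- The polynomials of all indices. -/
noncomputable def recPoly (k : ℝ) (n : ℤ) (z : ℂ) : ℂ :=
  if 1 ≤ n then posPoly k (n - 1).toNat z else Complex.exp z * posPoly k (-n).toNat (-z)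

theorem recPoly_natCast_add_one (k : ℝ) (l : ℕ) : recPoly k (l + 1) = posPoly k l := by
  ext z
  have : (1 : ℤ) ≤ l + 1 := by omega
  simp [recPoly, this]

theorem recPoly_neg_natCast (k : ℝ) (l : ℕ) (z : ℂ) :
    recPoly k (-l) z = Complex.exp z * posPoly k l (-z) := by
  have : ¬ (1 : ℤ) ≤ -l := by omega
  simp [recPoly, this]

theorem exists_nat_eq_add_one_or_neg (n : ℤ) : ∃ l : ℕ, n = l + 1 ∨ n = -l := by
  rcases le_or_gt 1 n with h | h
  · exact ⟨(n - 1).toNat, Or.inl (by omega)⟩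
  · exact ⟨(-n).toNat, Or.inr (by omega)⟩

theorem recPoly_one_sub (k : ℝ) (n : ℤ) (z : ℂ) :
    recPoly k (1 - n) z = Complex.exp z * recPoly k n (-z) := by
  obtain ⟨l, rfl | rfl⟩ := exists_nat_eq_add_one_or_neg n
  · rw [show (1 : ℤ) - (l + 1) = -l by ring, recPoly_neg_natCast, recPoly_natCast_add_one]
  · rw [show (1 : ℤ) - -l = l + 1 by ring, recPoly_natCast_add_one, recPoly_neg_natCast,
      ← mul_assoc, ← Complex.exp_add]
    simp

theorem recPoly_add_two (k : ℝ) (l : ℕ) (z : ℂ) :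
    recPoly k (l + 1 + 1) z = Complex.exp z * recPoly k (l + 1) z
      + recCoeff k (l + 1) * recPoly k (-l) z := by
  have := recPoly_natCast_add_one k (l + 1)
  push_cast at this
  rw [this, recPoly_natCast_add_one, recPoly_neg_natCast, posPoly]
  ring

theorem conj_posPoly (k : ℝ) (l : ℕ) (z : ℂ) :
    (starRingEnd ℂ) (posPoly k l z) = posPoly k l ((starRingEnd ℂ) z) := by
  induction l generalizing z with
  | zero => simp [posPoly, Complex.exp_conj]
  | succ l ih => simp [posPoly, ih, Complex.exp_conj]

theorem conj_recPoly (k : ℝ) (n : ℤ) (z : ℂ) :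
    (starRingEnd ℂ) (recPoly k n z) = recPoly k n ((starRingEnd ℂ) z) := by
  obtain ⟨l, rfl | rfl⟩ := exists_nat_eq_add_one_or_neg n
  · rw [recPoly_natCast_add_one, conj_posPoly]
  · rw [recPoly_neg_natCast, recPoly_neg_natCast, map_mul, conj_posPoly, Complex.exp_conj, map_neg]

theorem continuous_posPoly (k : ℝ) (l : ℕ) : Continuous (posPoly k l) := by
  induction l with
  | zero => exact Complex.continuous_exp
  | succ l ih => unfold posPoly; fun_prop

/-- All frequencies have the parity of `l + 1`. This yields the period `2π` and, later, the symmetry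
of the modulus about `π / 2`. -/
theorem posPoly_add_pi (k : ℝ) (l : ℕ) (z : ℂ) :
    posPoly k l (z + Complex.I * Real.pi) = (-1) ^ (l + 1) * posPoly k l z := by
  induction l generalizing z with
  | zero =>
    rw [mul_comm Complex.I]
    simp [posPoly, Complex.exp_add, Complex.exp_pi_mul_I]
  | succ l ih =>
    have h1 : posPoly k l (-(z + Complex.I * Real.pi)) = (-1) ^ (l + 1) * posPoly k l (-z) := by
      have := ih (-(z + Complex.I * Real.pi))
      rw [show -(z + Complex.I * Real.pi) + Complex.I * Real.pi = -z by ring] at this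
      rw [this, ← mul_assoc, ← mul_pow]
      simp
    have h2 : Complex.exp (z + Complex.I * Real.pi) = -Complex.exp z := by
      rw [mul_comm, Complex.exp_add, Complex.exp_pi_mul_I, mul_neg_one]
    simp only [posPoly]
    rw [ih, h1, h2]
    ring

/-- The eigenvalue of index `n` of the Cherednik operator. -/
noncomputable def eigenvalue (k : ℝ) (n : ℤ) : ℝ := if 1 ≤ n then n + k else n - k

theorem eigenvalue_one_sub (k : ℝ) (n : ℤ) : eigenvalue k (1 - n) = 1 - eigenvalue k n := by
  unfold eigenvalue
  split_ifs
  · omega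
  · push_cast; ring
  · push_cast; ring
  · omega

/-- Injectivity of the spectrum turns the eigenvalue equation into orthogonality; here `k ≥ 0` is
needed across the jump between the indices `0` and `1`. -/
theorem eigenvalue_strictMono {k : ℝ} (hk : 0 ≤ k) : StrictMono (eigenvalue k) := fun n m h => by
  have : (n : ℝ) < m := by exact_mod_cast h
  unfold eigenvalue
  split_ifs <;> linarith

theorem cherednikEigen_posPoly {k : ℝ} (hk : 0 ≤ k) (l : ℕ) :
    CherednikEigen k (l + 1 + k) fun x => posPoly k l (Complex.I * x) where
  cont := by have := continuous_posPoly k l; fun_prop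
  conj x := by rw [conj_posPoly]; simp
  per x := by
    have h1 := posPoly_add_pi k l (Complex.I * x)
    have h2 := posPoly_add_pi k l (Complex.I * x + Complex.I * Real.pi)
    rw [h1, ← mul_assoc, ← mul_pow] at h2
    simp only [mul_neg, mul_one, neg_neg, one_pow, one_mul] at h2
    rw [← h2]
    congr 1
    push_cast
    ring
  deriv x hx := by
    have hx' : (Real.sin x : ℂ) ≠ 0 := by exact_mod_cast hx
    have hconj : ∀ (l : ℕ) (y : ℝ), (starRingEnd ℂ) (posPoly k l (Complex.I * y))
        = posPoly k l (-(Complex.I * y)) := fun l y => by rw [conj_posPoly]; simp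
    induction l with
    | zero =>
      refine (CherednikEigen.hasDerivAt_exp x).congr_deriv ?_
      simp only [posPoly, CherednikEigen.exp_I_mul_eq, map_add, map_mul, Complex.conj_ofReal,
        Complex.conj_I, Nat.cast_zero, zero_add, Complex.ofReal_add, Complex.ofReal_one,
        Complex.ofReal_div]
      field_simp
      ring
    | succ l ih =>
      set a : ℝ → ℂ := fun y => posPoly k l (Complex.I * y) with ha
      replace ih : HasDerivAt a (Complex.I * (l + 1 + k : ℝ) * a x
          + Complex.I * k * (starRingEnd ℂ) (a x)
          - k * (Real.cos x / Real.sin x : ℝ) * (a x - (starRingEnd ℂ) (a x))) x := ih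
      have hrec : ∀ y : ℝ, posPoly k (l + 1) (Complex.I * y) = Complex.exp (Complex.I * y)
          * (a y + recCoeff k (l + 1) * (starRingEnd ℂ) (a y)) := fun y => by
        simp only [ha, posPoly, hconj]
      simp only [hrec]
      refine ((CherednikEigen.hasDerivAt_exp x).mul (ih.add
        ((CherednikEigen.hasDerivAt_conj ih).const_mul _))).congr_deriv ?_
      -- This identity fixes the recurrence coefficient: it is what lets the next polynomial satisfy
      -- the equation with eigenvalue raised by one.
      have hb : ((l : ℂ) + 1 + k) * recCoeff k (l + 1) = k := by
        have h0 : (l : ℝ) + 1 + k ≠ 0 := by positivity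
        have : ((l : ℝ) + 1 + k) * recCoeff k (l + 1) = k := by
          unfold recCoeff
          push_cast
          field_simp
        exact_mod_cast this
      change _ * (a x + _ * (starRingEnd ℂ) (a x)) + _ * _ = _
      simp only [map_mul, map_add, map_sub, Complex.conj_conj, Complex.conj_I,
        Complex.conj_ofReal, CherednikEigen.exp_I_mul_eq, Complex.ofReal_div, Complex.ofReal_add,
        Complex.ofReal_one, map_div₀, Complex.ofReal_natCast, Nat.cast_add, Nat.cast_one,
        Complex.conj_natCast, map_one]
      field_simp
      linear_combination (Real.cos x + Complex.I * Real.sin x) *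
        (-2 * Complex.I * Real.sin x * (starRingEnd ℂ) (a x)) * hb

theorem cherednikEigen_recPoly {k : ℝ} (hk : 0 ≤ k) (n : ℤ) :
    CherednikEigen k (eigenvalue k n) fun x => recPoly k n (Complex.I * x) := by
  obtain ⟨l, rfl | rfl⟩ := exists_nat_eq_add_one_or_neg n
  · have h := cherednikEigen_posPoly hk l
    have h1 : (1 : ℤ) ≤ l + 1 := by omega
    simpa [recPoly_natCast_add_one, eigenvalue, h1] using h
  · have h := (cherednikEigen_posPoly hk l).reflect
    have h1 : ¬ (1 : ℤ) ≤ -l := by omega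
    have h2 : 1 - ((l : ℝ) + 1 + k) = eigenvalue k (-l) := by
      rw [eigenvalue, if_neg h1]; push_cast; ring
    rw [h2] at h
    simpa [recPoly_neg_natCast, conj_posPoly] using h

/-! ### Triangularity and identification with the Heckman–Opdam polynomials -/

/-- The exponential polynomial with frequencies preceding `n`. -/
noncomputable def lowerSpan (n : ℤ) : Submodule ℂ (ℂ → ℂ) :=
  Submodule.span ℂ ((fun (j : ℤ) (z : ℂ) => Complex.exp (j * z)) '' {j | Precedes j n})

theorem exp_mem_lowerSpan {j n : ℤ} (h : Precedes j n) :
    (fun z : ℂ => Complex.exp (j * z)) ∈ lowerSpan n :=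
  Submodule.subset_span ⟨j, h, rfl⟩

/-- Substituting `z ↦ ε z` and multiplying by `e^z` maps lower spans to lower spans. -/
theorem exp_mul_comp_mem_lowerSpan {n m ε : ℤ} (h : ∀ j, Precedes j n → Precedes (1 + ε * j) m)
    {f : ℂ → ℂ} (hf : f ∈ lowerSpan n) :
    (fun z => Complex.exp z * f (ε * z)) ∈ lowerSpan m := by
  induction hf using Submodule.span_induction with
  | mem f hf =>
    obtain ⟨j, hj, rfl⟩ := hf
    have := exp_mem_lowerSpan (h j hj)
    convert! this using 2 with z
    rw [← Complex.exp_add]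
    push_cast
    ring_nf
  | zero => convert! (lowerSpan m).zero_mem using 2 with z; simp
  | add f g _ _ hf hg => convert! (lowerSpan m).add_mem hf hg using 2 with z; simp [mul_add]
  | smul r f _ hf =>
    convert! (lowerSpan m).smul_mem r hf using 2 with z
    simp only [Pi.smul_apply, smul_eq_mul]
    ring

theorem posPoly_sub_exp_mem (k : ℝ) (l : ℕ) :
    (fun z => posPoly k l z - Complex.exp ((l + 1 : ℤ) * z)) ∈ lowerSpan (l + 1) := by
  induction l with
  | zero => convert! (lowerSpan _).zero_mem using 2 with z; simp [posPoly]
  | succ l ih =>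
    have h1 := exp_mul_comp_mem_lowerSpan (n := l + 1) (m := (l + 1 : ℕ) + 1) (ε := 1)
      (fun j hj => by unfold Precedes at *; grind) ih
    have h2 := exp_mul_comp_mem_lowerSpan (n := l + 1) (m := (l + 1 : ℕ) + 1) (ε := -1)
      (fun j hj => by unfold Precedes at *; grind) ih
    -- The leading term of the reflected polynomial contributes the frequency `1 - (l + 1) = -l`,
    -- which precedes `l + 2`.
    have h3 : (fun z : ℂ => Complex.exp ((-l : ℤ) * z)) ∈ lowerSpan ((l + 1 : ℕ) + 1) :=
      exp_mem_lowerSpan (by unfold Precedes; grind)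
    convert! (lowerSpan _).add_mem h1 ((lowerSpan _).smul_mem (recCoeff k (l + 1) : ℂ)
      ((lowerSpan _).add_mem h2 h3)) using 2 with z
    have e1 : Complex.exp (((l + 1 : ℕ) + 1 : ℤ) * z)
        = Complex.exp z * Complex.exp ((l + 1 : ℤ) * z) := by
      rw [← Complex.exp_add]; push_cast; ring_nf
    have e2 : Complex.exp ((-l : ℤ) * z)
        = Complex.exp z * Complex.exp ((l + 1 : ℤ) * -z) := by
      rw [← Complex.exp_add]; push_cast; ring_nf
    simp only [Pi.add_apply, Pi.smul_apply, smul_eq_mul, posPoly, Int.cast_one, one_mul]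
    rw [e1, e2, show ((-1 : ℤ) : ℂ) * z = -z by push_cast; ring]
    ring

theorem recPoly_sub_exp_mem (k : ℝ) (n : ℤ) :
    (fun z => recPoly k n z - Complex.exp (n * z)) ∈ lowerSpan n := by
  obtain ⟨l, rfl | rfl⟩ := exists_nat_eq_add_one_or_neg n
  · rw [recPoly_natCast_add_one]
    exact posPoly_sub_exp_mem k l
  · have h := exp_mul_comp_mem_lowerSpan (n := l + 1) (m := -l) (ε := -1)
      (fun j hj => by unfold Precedes at *; grind) (posPoly_sub_exp_mem k l)
    convert! h using 2 with z
    have e2 : Complex.exp ((-l : ℤ) * z)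
        = Complex.exp z * Complex.exp ((l + 1 : ℤ) * -z) := by
      rw [← Complex.exp_add]; push_cast; ring_nf
    rw [recPoly_neg_natCast, e2]
    simp only [Int.cast_neg, Int.cast_one, neg_one_mul]
    ring

theorem exists_recPoly_eq (k : ℝ) (n : ℤ) : ∃ c : ℤ → ℂ, ∀ z : ℂ,
    recPoly k n z = Complex.exp (n * z) + ∑ j ∈ lower n, c j * Complex.exp (j * z) := by
  have h := recPoly_sub_exp_mem k n
  have hs : {j | Precedes j n} = (lower n : Set ℤ) := by ext j; simp [mem_lower]
  rw [lowerSpan, hs, Submodule.mem_span_image_finset_iff_exists_fun'] at h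
  obtain ⟨c, hc⟩ := h
  refine ⟨c, fun z => ?_⟩
  have := congrFun hc z
  simp only [Finset.sum_apply, Pi.smul_apply, smul_eq_mul] at this
  rw [this]
  ring

theorem innerK_smul_left (k : ℝ) (r : ℂ) (f g : ℝ → ℂ) :
    innerK k (fun x => r * f x) g = r * innerK k f g := by
  unfold innerK
  simp only [mul_assoc, intervalIntegral.integral_const_mul]
  ring

theorem continuous_recPoly {k : ℝ} (hk : 0 ≤ k) (n : ℤ) :
    Continuous fun x : ℝ => recPoly k n (Complex.I * x) := (cherednikEigen_recPoly hk n).cont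

theorem innerK_recPoly_eq_zero {k : ℝ} (hk : 0 ≤ k) {n m : ℤ} (h : n ≠ m) :
    innerK k (fun x => recPoly k n (Complex.I * x)) (fun x => recPoly k m (Complex.I * x)) = 0 :=
  (cherednikEigen_recPoly hk n).innerK_eq_zero hk (cherednikEigen_recPoly hk m)
    ((eigenvalue_strictMono hk).injective.ne h)

theorem Precedes.trans {i j n : ℤ} (h1 : Precedes i j) (h2 : Precedes j n) : Precedes i n := by
  unfold Precedes at *; grind

theorem Precedes.ne {j n : ℤ} (h : Precedes j n) : j ≠ n := by
  rintro rfl; simp [Precedes] at h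

/-- Orthogonality to the polynomials of lower index passes to the exponentials by triangularity. The
rank `2|j| + [j < 0]` decreases strictly along the order, because `|j|` itself precedes `-|j|`, so
induction on a bound for the rank applies. -/
theorem innerK_exp_recPoly_eq_zero {k : ℝ} (hk : 0 ≤ k) (N : ℕ) : ∀ j n : ℤ,
    2 * |j| + (if j < 0 then 1 else 0) < N → Precedes j n →
    innerK k (fun x => Complex.exp (Complex.I * j * x))
      (fun x => recPoly k n (Complex.I * x)) = 0 := by
  induction N with
  | zero => intro j n h; exfalso; have := abs_nonneg j; split_ifs at h <;> simp at h <;> omega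
  | succ N ih =>
    intro j n h hjn
    obtain ⟨c, hc⟩ := exists_recPoly_eq k j
    have hcont : ∀ j : ℤ, Continuous fun x : ℝ => Complex.exp (Complex.I * j * x) :=
      fun j => by fun_prop
    have hn := continuous_recPoly hk n
    have h1 := innerK_recPoly_eq_zero hk hjn.ne
    have h2 : (fun x : ℝ => recPoly k j (Complex.I * x)) = fun x : ℝ =>
        Complex.exp (Complex.I * j * x)
          + ∑ l ∈ lower j, c l * Complex.exp (Complex.I * l * x) := by
      ext x
      rw [hc]
      congr 1
      · ring_nf
      · exact Finset.sum_congr rfl fun l _ => by ring_nf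
    rw [h2, innerK_add_left hk (hcont j) (by fun_prop) hn, innerK_sum_left hk _ _ hcont hn,
      Finset.sum_eq_zero, add_zero] at h1
    · exact h1
    · intro l hl
      rw [mem_lower] at hl
      rw [ih l n ?_ (hl.trans hjn), mul_zero]
      unfold Precedes at hl
      push_cast at h
      split_ifs at * <;> grind

theorem isHOPoly_recPoly {k : ℝ} (hk : 0 ≤ k) (n : ℤ) : IsHOPoly k n (recPoly k n) := by
  refine ⟨exists_recPoly_eq k n, fun j hj => ?_⟩
  rw [innerK_conj, innerK_exp_recPoly_eq_zero hk
    (2 * |j| + (if j < 0 then 1 else 0) + 1).toNat j n _ hj, map_zero]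
  have := abs_nonneg j
  split_ifs <;> omega

theorem hoPoly_eq_recPoly {k : ℝ} (hk : 0 ≤ k) (n : ℤ) : hoPoly k n = recPoly k n :=
  (existsUnique_isHOPoly hk n).unique (isHOPoly_hoPoly hk n) (isHOPoly_recPoly hk n)

theorem innerK_self_eq_re (k : ℝ) (f : ℝ → ℂ) : innerK k f f = ((innerK k f f).re : ℂ) :=
  (Complex.conj_eq_iff_re.mp (innerK_conj k f f).symm).symm

theorem innerK_self_congr {k : ℝ} {f g : ℝ → ℂ} (h : ∀ x, ‖f x‖ = ‖g x‖) :
    innerK k f f = innerK k g g := by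
  unfold innerK
  simp only [Complex.mul_conj, Complex.normSq_eq_norm_sq, h]

theorem norm_recPoly_one_sub {k : ℝ} (n : ℤ) (x : ℝ) :
    ‖recPoly k (1 - n) (Complex.I * x)‖ = ‖recPoly k n (Complex.I * x)‖ := by
  have h : recPoly k n (-(Complex.I * x)) = (starRingEnd ℂ) (recPoly k n (Complex.I * x)) := by
    rw [conj_recPoly]; simp
  rw [recPoly_one_sub, norm_mul, h, Complex.norm_conj, mul_comm, mul_comm Complex.I,
    Complex.norm_exp_ofReal_mul_I, mul_one]

/-! ### Norms and the normalized recurrence -/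

/-- The squared norm of the polynomial of index `n`. -/
noncomputable def recNormSq (k : ℝ) (n : ℤ) : ℝ :=
  (innerK k (fun x => recPoly k n (Complex.I * x)) (fun x => recPoly k n (Complex.I * x))).re

theorem recNormSq_one_sub (k : ℝ) (n : ℤ) : recNormSq k (1 - n) = recNormSq k n := by
  unfold recNormSq
  rw [innerK_self_congr (norm_recPoly_one_sub n)]

/-- Pythagoras: `e^{ix} E_{l+1} = E_{l+2} - β E_{-l}` with orthogonal terms on the right, and
`E_{-l}` has the same modulus as `E_{l+1}`. -/
theorem recNormSq_add_two {k : ℝ} (hk : 0 ≤ k) (l : ℕ) :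
    recNormSq k (l + 1 + 1) = (1 - recCoeff k (l + 1) ^ 2) * recNormSq k (l + 1) := by
  set u : ℝ → ℂ := fun x => recPoly k (l + 1 + 1) (Complex.I * x) with hu
  set v : ℝ → ℂ := fun x => recPoly k (-l) (Complex.I * x) with hv
  set f : ℝ → ℂ := fun x => recPoly k (l + 1) (Complex.I * x) with hf
  set β : ℂ := (recCoeff k (l + 1) : ℂ) with hβ
  have hβc : (starRingEnd ℂ) β = β := Complex.conj_ofReal _
  have huc : Continuous u := continuous_recPoly hk _
  have hvc : Continuous v := continuous_recPoly hk _
  have huv : innerK k u v = 0 := innerK_recPoly_eq_zero hk (by omega)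
  have hvu : innerK k v u = 0 := innerK_recPoly_eq_zero hk (by omega)
  set w : ℝ → ℂ := fun x => u x + -β * v x with hw
  have hwc : Continuous w := by fun_prop
  have hwu : innerK k w u = innerK k u u := by
    rw [innerK_add_left hk huc (by fun_prop) huc, innerK_smul_left, hvu, mul_zero, add_zero]
  have hwv : innerK k w v = -β * innerK k v v := by
    rw [innerK_add_left hk huc (by fun_prop) hvc, innerK_smul_left, huv, zero_add]
  have hww : innerK k w w = innerK k u u + β ^ 2 * innerK k v v := by
    rw [innerK_add_left hk huc (by fun_prop) hwc, innerK_smul_left, innerK_conj k w u,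
      innerK_conj k w v, hwu, hwv, map_mul, map_neg, hβc, ← innerK_conj, ← innerK_conj]
    ring
  have hwf : innerK k w w = innerK k f f := by
    refine innerK_self_congr fun x => ?_
    have : w x = Complex.exp (x * Complex.I) * f x := by
      simp only [hw, hu, hv, hf, recPoly_add_two, hβ]
      rw [mul_comm (x : ℂ)]
      ring
    rw [this, norm_mul, Complex.norm_exp_ofReal_mul_I, one_mul]
  have hvv : innerK k v v = innerK k f f := by
    refine innerK_self_congr fun x => ?_
    have := norm_recPoly_one_sub (k := k) (l + 1) x
    rwa [show (1 : ℤ) - (l + 1) = -l by ring] at this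
  have : innerK k u u = ((1 - recCoeff k (l + 1) ^ 2 : ℝ) : ℂ) * innerK k f f := by
    rw [hwf, hvv] at hww
    push_cast
    linear_combination -hww
  change (innerK k u u).re = _ * (innerK k f f).re
  rw [this, Complex.re_ofReal_mul]

theorem recCoeff_nonneg {k : ℝ} (hk : 0 ≤ k) (l : ℕ) : 0 ≤ recCoeff k l := by
  unfold recCoeff; positivity

theorem recCoeff_lt_one {k : ℝ} (hk : 0 ≤ k) (l : ℕ) : recCoeff k (l + 1) < 1 := by
  unfold recCoeff
  rw [div_lt_one (by positivity)]
  push_cast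
  have : (0 : ℝ) ≤ l := by positivity
  linarith

theorem recNormSq_pos {k : ℝ} (hk : 0 ≤ k) (n : ℤ) : 0 < recNormSq k n := by
  have hnn : ∀ l : ℕ, 0 < recNormSq k (l + 1) := fun l => by
    induction l with
    | zero =>
      have hnonneg : 0 ≤ recNormSq k ((0 : ℕ) + 1) := by
        have hpi : (0 : ℝ) ≤ 2 * Real.pi := by positivity
        unfold recNormSq innerK
        simp only [Complex.mul_conj, ← Complex.ofReal_mul, intervalIntegral.integral_ofReal]
        rw [show (1 / (2 * Real.pi) : ℂ) = ((1 / (2 * Real.pi) : ℝ) : ℂ) by push_cast; rfl,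
          ← Complex.ofReal_mul, Complex.ofReal_re]
        refine mul_nonneg (by positivity) (intervalIntegral.integral_nonneg hpi fun x _ =>
          mul_nonneg (Complex.normSq_nonneg _) (weight_nonneg k x))
      refine lt_of_le_of_ne hnonneg fun h0 => ?_
      have h1 : innerK k (fun x => recPoly k ((0 : ℕ) + 1) (Complex.I * x))
          (fun x => recPoly k ((0 : ℕ) + 1) (Complex.I * x)) = 0 := by
        rw [innerK_self_eq_re]
        exact_mod_cast h0.symm
      have h2 := eq_zero_of_innerK_self hk (continuous_recPoly hk _) h1
      have h3 : ∀ᵐ x : ℝ, x ∉ Set.uIoc (0 : ℝ) (2 * Real.pi) := by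
        filter_upwards [h2] with x hx hxm
        have := hx hxm
        rw [recPoly_natCast_add_one] at this
        exact Complex.exp_ne_zero _ this
      rw [MeasureTheory.ae_iff] at h3
      simp only [not_not, Set.ofPred_mem_eq, Set.uIoc_of_le (by positivity : (0 : ℝ) ≤ 2 * Real.pi),
        Real.volume_Ioc, sub_zero, ENNReal.ofReal_eq_zero] at h3
      linarith [Real.pi_pos]
    | succ l ih =>
      have := recNormSq_add_two hk l
      push_cast
      rw [this]
      have h0 := recCoeff_nonneg hk (l + 1)
      have h1 := recCoeff_lt_one hk l
      exact mul_pos (by nlinarith) ih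
  obtain ⟨l, rfl | rfl⟩ := exists_nat_eq_add_one_or_neg n
  · exact hnn l
  · rw [← recNormSq_one_sub, show (1 : ℤ) - -l = l + 1 by ring]
    exact hnn l

/-- The restriction of the normalized polynomial to the imaginary axis. -/
noncomputable def hoFun (k : ℝ) (n : ℤ) (x : ℝ) : ℂ := hoNormalized k n (Complex.I * x)

theorem hoNormalized_eq {k : ℝ} (hk : 0 ≤ k) (n : ℤ) (z : ℂ) :
    hoNormalized k n z = ((Real.sqrt (recNormSq k n))⁻¹ : ℝ) * recPoly k n z := by
  rw [hoNormalized, hoPoly_eq_recPoly hk, normK, recNormSq]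
  push_cast
  ring

theorem hoFun_eq {k : ℝ} (hk : 0 ≤ k) (n : ℤ) (x : ℝ) :
    hoFun k n x = ((Real.sqrt (recNormSq k n))⁻¹ : ℝ) * recPoly k n (Complex.I * x) :=
  hoNormalized_eq hk n _

theorem hoNormalized_neg {k : ℝ} (hk : 0 ≤ k) (n : ℤ) (x : ℝ) :
    hoNormalized k n (-(Complex.I * x)) = (starRingEnd ℂ) (hoFun k n x) := by
  rw [hoFun_eq hk, hoNormalized_eq hk, map_mul, Complex.conj_ofReal, conj_recPoly]
  simp

theorem cherednikEigen_hoFun {k : ℝ} (hk : 0 ≤ k) (n : ℤ) :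
    CherednikEigen k (eigenvalue k n) (hoFun k n) := by
  have := (cherednikEigen_recPoly hk n).smul (Real.sqrt (recNormSq k n))⁻¹
  convert! this using 2 with x
  exact hoFun_eq hk n x

theorem hoFun_one_sub {k : ℝ} (hk : 0 ≤ k) (n : ℤ) (x : ℝ) :
    hoFun k (1 - n) x = Complex.exp (Complex.I * x) * (starRingEnd ℂ) (hoFun k n x) := by
  rw [← hoNormalized_neg hk, hoFun_eq hk, hoNormalized_eq hk, recNormSq_one_sub, recPoly_one_sub]
  ring

theorem norm_hoFun_one_sub {k : ℝ} (hk : 0 ≤ k) (n : ℤ) (x : ℝ) :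
    ‖hoFun k (1 - n) x‖ = ‖hoFun k n x‖ := by
  rw [hoFun_one_sub hk, norm_mul, mul_comm Complex.I, Complex.norm_exp_ofReal_mul_I, one_mul,
    Complex.norm_conj]

/-- The complementary recurrence coefficient. -/
noncomputable def recCoeff' (k : ℝ) (n : ℕ) : ℝ := Real.sqrt (1 - recCoeff k n ^ 2)

theorem recCoeff'_sq {k : ℝ} (hk : 0 ≤ k) (l : ℕ) :
    recCoeff' k (l + 1) ^ 2 = 1 - recCoeff k (l + 1) ^ 2 := by
  have h0 := recCoeff_nonneg hk (l + 1)
  have h1 := recCoeff_lt_one hk l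
  exact Real.sq_sqrt (by nlinarith)

theorem recCoeff'_pos {k : ℝ} (hk : 0 ≤ k) (l : ℕ) : 0 < recCoeff' k (l + 1) := by
  have h0 := recCoeff_nonneg hk (l + 1)
  have h1 := recCoeff_lt_one hk l
  exact Real.sqrt_pos.mpr (by nlinarith)

theorem exp_mul_hoFun_add_one {k : ℝ} (hk : 0 ≤ k) (l : ℕ) (x : ℝ) :
    Complex.exp (Complex.I * x) * hoFun k (l + 1) x
      = recCoeff' k (l + 1) * hoFun k (l + 1 + 1) x - recCoeff k (l + 1) * hoFun k (-l) x := by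
  have hN := recNormSq_pos hk (l + 1)
  have hs : Real.sqrt (recNormSq k (l + 1)) ≠ 0 := (Real.sqrt_pos.mpr hN).ne'
  have hγ := (recCoeff'_pos hk l).ne'
  have h1 : Real.sqrt (recNormSq k (l + 1 + 1))
      = recCoeff' k (l + 1) * Real.sqrt (recNormSq k (l + 1)) := by
    rw [recNormSq_add_two hk, Real.sqrt_mul' _ hN.le, recCoeff']
  have h2 : recNormSq k (-l) = recNormSq k (l + 1) := by
    rw [← recNormSq_one_sub, show (1 : ℤ) - -l = l + 1 by ring]
  rw [hoFun_eq hk, hoFun_eq hk, hoFun_eq hk, h1, h2, recPoly_add_two]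
  have hs' : (Real.sqrt (recNormSq k (l + 1)) : ℂ) ≠ 0 := by exact_mod_cast hs
  have hγ' : (recCoeff' k (l + 1) : ℂ) ≠ 0 := by exact_mod_cast hγ
  push_cast
  field_simp
  ring

/-- This is the second row of a rotation whose first row is `exp_mul_hoFun_add_one`. It follows by
conjugating that identity and using `𝓔_{1-n} = e^{ix} conj 𝓔_n`. -/
theorem exp_mul_hoFun_neg {k : ℝ} (hk : 0 ≤ k) (l : ℕ) (x : ℝ) :
    Complex.exp (Complex.I * x) * hoFun k (-(l + 1 : ℕ)) x
      = recCoeff k (l + 1) * hoFun k (l + 1 + 1) x + recCoeff' k (l + 1) * hoFun k (-l) x := by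
  have hγ : (recCoeff' k (l + 1) : ℂ) ≠ 0 := by exact_mod_cast (recCoeff'_pos hk l).ne'
  have h1 := exp_mul_hoFun_add_one hk l x
  have h2 := congrArg (starRingEnd ℂ) h1
  simp only [map_mul, map_sub, Complex.conj_ofReal, CherednikEigen.conj_exp] at h2
  have r1 := hoFun_one_sub hk (l + 1) x
  have r2 := hoFun_one_sub hk (l + 1 + 1) x
  have r3 := hoFun_one_sub hk (-l) x
  rw [show (1 : ℤ) - (l + 1) = -l by ring] at r1
  rw [show (1 : ℤ) - (l + 1 + 1) = -(l + 1 : ℕ) by push_cast; ring] at r2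
  rw [show (1 : ℤ) - -l = l + 1 by ring] at r3
  have hsq : (recCoeff' k (l + 1) : ℂ) ^ 2 = 1 - (recCoeff k (l + 1) : ℂ) ^ 2 := by
    exact_mod_cast recCoeff'_sq hk l
  have he : Complex.exp (Complex.I * x) * Complex.exp (-(Complex.I * x)) = 1 := by
    rw [← Complex.exp_add]; simp
  set e := Complex.exp (Complex.I * x)
  have h3 : recCoeff' k (l + 1) * (e * hoFun k (-(l + 1 : ℕ)) x)
      = hoFun k (-l) x + recCoeff k (l + 1) * (e * hoFun k (l + 1) x) := by
    rw [r2, r1]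
    nth_rewrite 2 [r3]
    linear_combination (-e ^ 2) * h2 + (e * (starRingEnd ℂ) (hoFun k (l + 1) x)) * he
  rw [h1] at h3
  refine mul_left_cancel₀ hγ ?_
  rw [h3]
  linear_combination (-hoFun k (-l) x) * hsq

/-- At `x = 0` the values of `𝓔_{-l}` and `𝓔_{l+1}` coincide, so the recurrence gives the ratio `(1
+ β) / (1 - β)` of squared moduli. -/
theorem norm_hoFun_zero_sq {k : ℝ} (hk : 0 ≤ k) (l : ℕ) :
    ‖hoFun k (l + 1 + 1) 0‖ ^ 2 = (1 + 2 * k / (l + 1)) * ‖hoFun k (l + 1) 0‖ ^ 2 := by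
  have h1 := exp_mul_hoFun_add_one hk l 0
  have h2 := hoFun_one_sub hk (l + 1) 0
  rw [show (1 : ℤ) - (l + 1) = -l by ring, (cherednikEigen_hoFun hk _).conj] at h2
  simp only [Complex.ofReal_zero, mul_zero, Complex.exp_zero, one_mul, neg_zero] at h1 h2
  rw [h2] at h1
  have h3 : (recCoeff' k (l + 1) : ℂ) * hoFun k (l + 1 + 1) 0
      = ((1 + recCoeff k (l + 1) : ℝ) : ℂ) * hoFun k (l + 1) 0 := by
    push_cast; linear_combination -h1
  have h4 := congrArg (fun z => ‖z‖ ^ 2) h3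
  simp only [norm_mul, Complex.norm_real, mul_pow, Real.norm_eq_abs, sq_abs] at h4
  rw [recCoeff'_sq hk] at h4
  have h0 := recCoeff_nonneg hk (l + 1)
  have hl := recCoeff_lt_one hk l
  have h5 : (1 - recCoeff k (l + 1)) * (1 + 2 * k / (l + 1)) = 1 + recCoeff k (l + 1) := by
    unfold recCoeff
    push_cast
    field_simp
    ring
  have h6 : (1 - recCoeff k (l + 1) ^ 2) ≠ 0 := by nlinarith
  refine mul_left_cancel₀ h6 ?_
  rw [h4]
  linear_combination (-(1 + recCoeff k (l + 1)) * ‖hoFun k (l + 1) 0‖ ^ 2) * h5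

/-! ### Energy estimates for the real and imaginary parts -/

section Energy

variable {k ν : ℝ} {p q : ℝ → ℝ}

theorem energy_hasDerivAt {x : ℝ} (hp : HasDerivAt p (-ν * q x) x)
    (hq : HasDerivAt q ((ν + 2 * k) * p x - 2 * k * (Real.cos x / Real.sin x) * q x) x) :
    HasDerivAt (fun y => (ν + 2 * k) * p y ^ 2 + ν * q y ^ 2)
      (-(4 * k * ν * (Real.cos x / Real.sin x) * q x ^ 2)) x := by
  refine (((hp.pow 2).const_mul _).add ((hq.pow 2).const_mul _)).congr_deriv ?_
  simp only [Nat.cast_ofNat, Nat.add_one_sub_one, pow_one]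
  ring

/-- The energy derivative is `-4kν cot x · q²`, and the cotangent is nonnegative up to `π / 2`. -/
theorem energy_le (hk : 0 ≤ k) (hν : 0 ≤ ν) (hpc : Continuous p) (hqc : Continuous q)
    (hp : ∀ x, Real.sin x ≠ 0 → HasDerivAt p (-ν * q x) x)
    (hq : ∀ x, Real.sin x ≠ 0 →
      HasDerivAt q ((ν + 2 * k) * p x - 2 * k * (Real.cos x / Real.sin x) * q x) x)
    {x : ℝ} (hx : x ∈ Set.Icc 0 (Real.pi / 2)) :
    (ν + 2 * k) * p x ^ 2 + ν * q x ^ 2 ≤ (ν + 2 * k) * p 0 ^ 2 + ν * q 0 ^ 2 := by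
  have hanti : AntitoneOn (fun y => (ν + 2 * k) * p y ^ 2 + ν * q y ^ 2)
      (Set.Icc 0 (Real.pi / 2)) := by
    refine antitoneOn_of_hasDerivWithinAt_nonpos (convex_Icc _ _)
      (f' := fun x => -(4 * k * ν * (Real.cos x / Real.sin x) * q x ^ 2))
      (Continuous.continuousOn (by fun_prop)) (fun y hy => ?_) (fun y hy => ?_)
    · rw [interior_Icc] at hy
      have hs := Real.sin_pos_of_pos_of_lt_pi hy.1 (by linarith [hy.2, Real.pi_pos])
      exact (energy_hasDerivAt (hp y hs.ne') (hq y hs.ne')).hasDerivWithinAt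
    · rw [interior_Icc] at hy
      have hs := Real.sin_pos_of_pos_of_lt_pi hy.1 (by linarith [hy.2, Real.pi_pos])
      have hc := Real.cos_pos_of_mem_Ioo ⟨by linarith [hy.1, Real.pi_pos], hy.2⟩
      have : 0 ≤ 4 * k * ν * (Real.cos y / Real.sin y) * q y ^ 2 := by positivity
      linarith
  exact hanti ⟨le_rfl, by positivity⟩ hx hx.1

theorem cos_div_sin_le {x : ℝ} (h0 : 0 < x) (h1 : x ≤ Real.pi / 2) :
    Real.cos x / Real.sin x ≤ 1 / x := by
  have hs := Real.sin_pos_of_pos_of_lt_pi h0 (by linarith [Real.pi_pos])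
  rcases h1.lt_or_eq with h | h
  · have hc := Real.cos_pos_of_mem_Ioo ⟨by linarith [Real.pi_pos], h⟩
    have := Real.lt_tan h0 h
    rw [Real.tan_eq_sin_div_cos, lt_div_iff₀ hc] at this
    rw [div_le_div_iff₀ hs h0]
    linarith
  · rw [h, Real.cos_pi_div_two, zero_div]
    positivity

/-- With `e` the energy, `(e δ_k)' = k cot x · (2pq δ_k)'`, an oscillating quantity. Subtracting `k
cot x · 2pq δ_k` leaves only `k 2pq δ_k / sin²`. If `Y` is the maximum of `e δ_k` on `[x₀, π/2]`,
this is at most `k Y / (ν sin²)`, which the derivative of `(k/ν) Y cot x` absorbs. The corrected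
energy `z` is thus nonincreasing. For `x ≤ x₀` the bound follows from `energy_le` and `sin x ≤ x`.
-/
theorem energy_mul_weight_le (hk : 0 ≤ k) (hν : 0 < ν) (hpc : Continuous p) (hqc : Continuous q)
    (hp : ∀ x, Real.sin x ≠ 0 → HasDerivAt p (-ν * q x) x)
    (hq : ∀ x, Real.sin x ≠ 0 →
      HasDerivAt q ((ν + 2 * k) * p x - 2 * k * (Real.cos x / Real.sin x) * q x) x)
    {x : ℝ} (hx : x ∈ Set.Icc 0 (Real.pi / 2)) :
    ((ν + 2 * k) * p x ^ 2 + ν * q x ^ 2) * weight k x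
      ≤ 5 / 2 * (((ν + 2 * k) * p 0 ^ 2 + ν * q 0 ^ 2) * (8 * k / ν) ^ (2 * k)) := by
  set e : ℝ → ℝ := fun y => (ν + 2 * k) * p y ^ 2 + ν * q y ^ 2 with he
  have hpi := Real.pi_pos
  have he0 : ∀ y, 0 ≤ e y := fun y => by positivity
  have hw := continuous_weight hk
  have hec : Continuous e := by fun_prop
  have small : ∀ y ∈ Set.Icc 0 (Real.pi / 2), y ≤ 4 * k / ν →
      e y * weight k y ≤ e 0 * (8 * k / ν) ^ (2 * k) := fun y hy hyk => by
    refine mul_le_mul (energy_le hk hν.le hpc hqc hp hq hy) ?_ (weight_nonneg k y) (he0 0)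
    have hs : 0 ≤ Real.sin y := Real.sin_nonneg_of_nonneg_of_le_pi hy.1 (by linarith [hy.2])
    rw [weight, abs_of_nonneg (by positivity)]
    refine Real.rpow_le_rpow (by positivity) ?_ (by positivity)
    have := Real.sin_le hy.1
    calc 2 * Real.sin y ≤ 2 * (4 * k / ν) := by linarith
      _ = 8 * k / ν := by ring
  have hB : 0 ≤ e 0 * (8 * k / ν) ^ (2 * k) := mul_nonneg (he0 0) (by positivity)
  change e x * weight k x ≤ 5 / 2 * (e 0 * (8 * k / ν) ^ (2 * k))
  rcases le_or_gt x (4 * k / ν) with hxk | hxk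
  · linarith [small x hx hxk]
  -- For `k = 0` the threshold `4k / ν` degenerates to `0`, but the weight is then constant.
  rcases hk.eq_or_lt with hk0 | hk0
  · have hw1 : weight k x = 1 := by simp [weight, ← hk0]
    have hw2 : (8 * k / ν) ^ (2 * k) = 1 := by simp [← hk0]
    rw [hw1, hw2, mul_one, mul_one]
    have h1 : e x ≤ e 0 := energy_le hk hν.le hpc hqc hp hq hx
    linarith [he0 0]
  -- From this point on `k cot x ≤ k / x ≤ ν / 4`, so each correction costs at most a quarter of the
  -- main term.
  set x₀ := 4 * k / ν with hx₀
  have hx₀pos : 0 < x₀ := by positivity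
  have hx₀x : x₀ ≤ Real.pi / 2 := hxk.le.trans hx.2
  obtain ⟨t, ht, htmax⟩ := isCompact_Icc.exists_isMaxOn (Set.nonempty_Icc.mpr hx₀x)
    ((hec.mul hw).continuousOn (s := Set.Icc x₀ (Real.pi / 2)))
  set Y := e t * weight k t with hY
  have hY0 : 0 ≤ Y := mul_nonneg (he0 t) (weight_nonneg k t)
  have hmax : ∀ y ∈ Set.Icc x₀ (Real.pi / 2), e y * weight k y ≤ Y := fun y hy => htmax hy
  have hpq : ∀ y, |2 * p y * q y| ≤ e y / ν := fun y => by
    have h1 : |2 * p y * q y| ≤ p y ^ 2 + q y ^ 2 :=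
      abs_le.mpr ⟨by nlinarith [sq_nonneg (p y + q y)], by nlinarith [sq_nonneg (p y - q y)]⟩
    have h2 : 0 ≤ 2 * k * p y ^ 2 := by positivity
    rw [le_div_iff₀ hν]
    calc |2 * p y * q y| * ν ≤ (p y ^ 2 + q y ^ 2) * ν := mul_le_mul_of_nonneg_right h1 hν.le
      _ ≤ e y := by simp only [he]; linarith
  have hsin : ∀ y ∈ Set.Icc x₀ (Real.pi / 2), 0 < Real.sin y := fun y hy =>
    Real.sin_pos_of_pos_of_lt_pi (by linarith [hy.1]) (by linarith [hy.2])
  have hcot0 : ∀ y ∈ Set.Icc x₀ (Real.pi / 2), 0 ≤ Real.cos y / Real.sin y := fun y hy =>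
    div_nonneg (Real.cos_nonneg_of_mem_Icc ⟨by linarith [hy.1], hy.2⟩) (hsin y hy).le
  have hcot : ∀ y ∈ Set.Icc x₀ (Real.pi / 2), k * (Real.cos y / Real.sin y) ≤ ν / 4 :=
    fun y hy => by
      have h1 := cos_div_sin_le (hx₀pos.trans_le hy.1) hy.2
      have h2 : 1 / y ≤ 1 / x₀ := one_div_le_one_div_of_le hx₀pos hy.1
      calc k * (Real.cos y / Real.sin y) ≤ k * (1 / x₀) :=
            mul_le_mul_of_nonneg_left (h1.trans h2) hk
        _ = ν / 4 := by rw [hx₀]; field_simp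
  -- the corrected energy and its derivative
  set z : ℝ → ℝ := fun y => e y * weight k y
    - k * (Real.cos y / Real.sin y) * (weight k y * (2 * p y * q y))
    + k / ν * Y * (Real.cos y / Real.sin y) with hz
  have hcorr : ∀ y ∈ Set.Icc x₀ (Real.pi / 2),
      |k * (Real.cos y / Real.sin y) * (weight k y * (2 * p y * q y))|
        ≤ e y * weight k y / 4 := fun y hy => by
    have h1 := hcot0 y hy
    have h2 := weight_nonneg k y
    rw [abs_mul, abs_mul (weight k y), abs_of_nonneg (mul_nonneg hk h1), abs_of_nonneg h2]
    calc k * (Real.cos y / Real.sin y) * (weight k y * |2 * p y * q y|)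
        ≤ ν / 4 * (weight k y * (e y / ν)) := by
          refine mul_le_mul (hcot y hy) (mul_le_mul_of_nonneg_left (hpq y) h2)
            (by positivity) (by positivity)
      _ = e y * weight k y / 4 := by field_simp
  have hzd : ∀ y ∈ Set.Icc x₀ (Real.pi / 2), HasDerivAt z
      (k * (weight k y * (2 * p y * q y) - Y / ν) / Real.sin y ^ 2) y := fun y hy => by
    have hs := (hsin y hy).ne'
    have h1 := energy_hasDerivAt (hp y hs) (hq y hs)
    have h2 := hasDerivAt_weight k hs
    have h3 := (Real.hasDerivAt_cos y).div (Real.hasDerivAt_sin y) hs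
    refine (((h1.mul h2).sub ((h3.const_mul k).mul (h2.mul (((hp y hs).const_mul 2).mul
      (hq y hs))))).add (h3.const_mul (k / ν * Y))).congr_deriv ?_
    have hcs : Real.cos y ^ 2 = 1 - Real.sin y ^ 2 := by linarith [Real.sin_sq_add_cos_sq y]
    simp only [Pi.mul_apply, Pi.div_apply]
    field_simp
    linear_combination (2 * q y * p y * ν * weight k y - Y) * hcs
  have hanti : AntitoneOn z (Set.Icc x₀ (Real.pi / 2)) := by
    refine antitoneOn_of_hasDerivWithinAt_nonpos (convex_Icc _ _)
      (fun y hy => (hzd y hy).continuousAt.continuousWithinAt)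
      (fun y hy => (hzd y (interior_subset hy)).hasDerivWithinAt) (fun y hy => ?_)
    replace hy := interior_subset hy
    refine div_nonpos_of_nonpos_of_nonneg (mul_nonpos_of_nonneg_of_nonpos hk ?_) (sq_nonneg _)
    have h2 := weight_nonneg k y
    have h3 : weight k y * (2 * p y * q y) ≤ weight k y * (e y / ν) :=
      mul_le_mul_of_nonneg_left ((le_abs_self _).trans (hpq y)) h2
    have h4 : weight k y * (e y / ν) ≤ Y / ν := by
      rw [← mul_div_assoc, mul_comm]
      exact div_le_div_of_nonneg_right (hmax y hy) hν.le
    linarith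
  have hx₀mem : x₀ ∈ Set.Icc x₀ (Real.pi / 2) := ⟨le_rfl, hx₀x⟩
  have h1 : z t ≤ z x₀ := hanti hx₀mem ht ht.1
  have h2 := abs_le.mp (hcorr t ht)
  have h3 := abs_le.mp (hcorr x₀ hx₀mem)
  have h4 : 0 ≤ k / ν * Y * (Real.cos t / Real.sin t) :=
    mul_nonneg (by positivity) (hcot0 t ht)
  have h5 : k / ν * Y * (Real.cos x₀ / Real.sin x₀) ≤ Y / 4 := by
    calc k / ν * Y * (Real.cos x₀ / Real.sin x₀)
        = Y / ν * (k * (Real.cos x₀ / Real.sin x₀)) := by ring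
      _ ≤ Y / ν * (ν / 4) := mul_le_mul_of_nonneg_left (hcot x₀ hx₀mem) (by positivity)
      _ = Y / 4 := by field_simp
  have h6 := small x₀ ⟨hx₀pos.le, hx₀x⟩ le_rfl
  have h7 := hmax x ⟨hxk.le, hx.2⟩
  -- Comparing `z` at `t` and `x₀` gives `3Y/4 ≤ (5/4) e(x₀) δ_k(x₀) + Y/4`, hence the factor `5/2`.
  simp only [hz] at h1
  linarith [h2.1, h2.2, h3.1, h3.2]

end Energy

/-! ### Uniform pointwise bounds for the normalized polynomials -/

/-- The product of the ratios `1 + 2k/j` is at most `exp(2k H_l)`, and the harmonic number satisfies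
`H_l ≤ 1 + log(l + 1)`. -/
theorem norm_hoFun_zero_sq_le {k : ℝ} (hk : 0 ≤ k) (l : ℕ) :
    ‖hoFun k (l + 1) 0‖ ^ 2
      ≤ ‖hoFun k 1 0‖ ^ 2 * Real.exp (2 * k) * ((l : ℝ) + 1) ^ (2 * k) := by
  have h1 : ‖hoFun k (l + 1) 0‖ ^ 2 ≤ ‖hoFun k 1 0‖ ^ 2 * Real.exp (2 * k * harmonic l) := by
    induction l with
    | zero => simp
    | succ l ih =>
      push_cast
      rw [norm_hoFun_zero_sq hk]
      have h2 : 1 + 2 * k / (l + 1) ≤ Real.exp (2 * k / (l + 1)) := by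
        linarith [Real.add_one_le_exp (2 * k / ((l : ℝ) + 1))]
      calc (1 + 2 * k / (l + 1)) * ‖hoFun k (l + 1) 0‖ ^ 2
          ≤ Real.exp (2 * k / (l + 1))
            * (‖hoFun k 1 0‖ ^ 2 * Real.exp (2 * k * harmonic l)) :=
          mul_le_mul h2 ih (by positivity) (by positivity)
        _ = ‖hoFun k 1 0‖ ^ 2 * Real.exp (2 * k * harmonic (l + 1)) := by
          rw [mul_left_comm, ← Real.exp_add, harmonic_succ]
          push_cast
          ring_nf
  refine h1.trans ?_
  rw [mul_assoc (‖hoFun k 1 0‖ ^ 2)]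
  refine mul_le_mul_of_nonneg_left ?_ (by positivity)
  have hl : (0 : ℝ) < (l : ℝ) + 1 := by positivity
  rw [Real.rpow_def_of_pos hl, ← Real.exp_add, Real.exp_le_exp]
  have h2 : (harmonic l : ℝ) ≤ 1 + Real.log (l + 1) := by
    rcases Nat.eq_zero_or_pos l with rfl | h
    · simp
    · refine (harmonic_le_one_add_log l).trans ?_
      have : (0 : ℝ) < l := by exact_mod_cast h
      linarith [Real.log_le_log this (by linarith : (l : ℝ) ≤ l + 1)]
  nlinarith

theorem exists_mem_quarter_period {k lam : ℝ} {a : ℝ → ℂ} (ha : CherednikEigen k lam a)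
    (hpi : ∀ x, ‖a (Real.pi - x)‖ = ‖a x‖) {x : ℝ} (hx : x ∈ Set.Icc 0 (2 * Real.pi)) :
    ∃ y : ℝ, y ∈ Set.Icc 0 (Real.pi / 2) ∧ ‖a x‖ = ‖a y‖ ∧ weight k x = weight k y := by
  have half : ∀ y ∈ Set.Icc (0 : ℝ) Real.pi,
      ∃ t : ℝ, t ∈ Set.Icc 0 (Real.pi / 2) ∧ ‖a y‖ = ‖a t‖ ∧ weight k y = weight k t := fun y hy => by
    rcases le_total y (Real.pi / 2) with h | h
    · exact ⟨y, ⟨hy.1, h⟩, rfl, rfl⟩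
    · refine ⟨Real.pi - y, ⟨by linarith [hy.2], by linarith⟩, (hpi y).symm, ?_⟩
      simp [weight, Real.sin_pi_sub]
  rcases le_total x Real.pi with h | h
  · exact half x ⟨hx.1, h⟩
  · obtain ⟨t, ht, h1, h2⟩ := half (2 * Real.pi - x) ⟨by linarith [hx.2], by linarith⟩
    refine ⟨t, ht, ?_, ?_⟩
    · rw [← h1, ha.two_pi_sub, Complex.norm_conj]
    · rw [← h2, weight_two_pi_sub]

theorem norm_hoFun_pi_sub {k : ℝ} (hk : 0 ≤ k) (l : ℕ) (x : ℝ) :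
    ‖hoFun k (l + 1) (Real.pi - x)‖ = ‖hoFun k (l + 1) x‖ := by
  have h := posPoly_add_pi k l (Complex.I * (-x : ℝ))
  rw [show Complex.I * (-x : ℝ) + Complex.I * Real.pi = Complex.I * (Real.pi - x : ℝ) by
    push_cast; ring] at h
  have h2 : ‖hoFun k (l + 1) (Real.pi - x)‖ = ‖hoFun k (l + 1) (-x)‖ := by
    rw [hoFun_eq hk, hoFun_eq hk, recPoly_natCast_add_one, h]
    simp
  rw [h2, ← (cherednikEigen_hoFun hk _).conj, Complex.norm_conj]

/-- The energy estimates apply with `ν = l + 1`, since the eigenvalue is `ν + k`. The symmetries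
about `π` and `π / 2` reduce `x` to `[0, π/2]`, and the imaginary part vanishes at `0`. -/
theorem hoFun_pos_bounds {k : ℝ} (hk : 0 ≤ k) (l : ℕ) {x : ℝ}
    (hx : x ∈ Set.Icc 0 (2 * Real.pi)) :
    ‖hoFun k (l + 1) x‖ ^ 2 ≤ (1 + 2 * k) * ‖hoFun k (l + 1) 0‖ ^ 2 ∧
    ‖hoFun k (l + 1) x‖ ^ 2 * weight k x
      ≤ 5 / 2 * (1 + 2 * k) * ‖hoFun k (l + 1) 0‖ ^ 2 * (8 * k / (l + 1)) ^ (2 * k) := by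
  have ha := cherednikEigen_hoFun hk (l + 1)
  obtain ⟨y, hy, h1, h2⟩ := exists_mem_quarter_period ha (norm_hoFun_pi_sub hk l) hx
  rw [h1, h2]
  clear h1 h2 hx x
  set a := hoFun k (l + 1) with hadef
  have hlam : eigenvalue k (l + 1) = (l + 1 : ℝ) + k := by
    have h1 : (1 : ℤ) ≤ l + 1 := by omega
    simp [eigenvalue, h1]
  rw [hlam] at ha
  set ν : ℝ := (l + 1 : ℝ) with hν
  have hν1 : 1 ≤ ν := by have : (0 : ℝ) ≤ l := by positivity
                         linarith
  set p : ℝ → ℝ := fun x => (a x).re with hpdef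
  set q : ℝ → ℝ := fun x => (a x).im with hqdef
  have hpc : Continuous p := Complex.continuous_re.comp ha.cont
  have hqc : Continuous q := Complex.continuous_im.comp ha.cont
  have hp : ∀ x, Real.sin x ≠ 0 → HasDerivAt p (-ν * q x) x := fun x hx => by
    refine (Complex.reCLM.hasFDerivAt.comp_hasDerivAt x (ha.deriv x hx)).congr_deriv ?_
    generalize Real.cos x / Real.sin x = r
    simp [hqdef]
    ring
  have hq : ∀ x, Real.sin x ≠ 0 →
      HasDerivAt q ((ν + 2 * k) * p x - 2 * k * (Real.cos x / Real.sin x) * q x) x :=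
    fun x hx => by
    refine (Complex.imCLM.hasFDerivAt.comp_hasDerivAt x (ha.deriv x hx)).congr_deriv ?_
    generalize Real.cos x / Real.sin x = r
    simp [hqdef, hpdef]
    ring
  have hq0 : q 0 = 0 := by
    have := ha.conj 0
    rw [neg_zero] at this
    exact Complex.conj_eq_iff_im.mp this
  have hnorm : ∀ x, ‖a x‖ ^ 2 = p x ^ 2 + q x ^ 2 := fun x => by
    rw [← Complex.normSq_eq_norm_sq, Complex.normSq_apply]; ring
  have hlow : ∀ x, ν * ‖a x‖ ^ 2 ≤ (ν + 2 * k) * p x ^ 2 + ν * q x ^ 2 := fun x => by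
    rw [hnorm]
    have : 0 ≤ 2 * k * p x ^ 2 := by positivity
    linarith
  have h0 : (ν + 2 * k) * p 0 ^ 2 + ν * q 0 ^ 2 ≤ ν * ((1 + 2 * k) * ‖a 0‖ ^ 2) := by
    rw [hnorm, hq0]
    have : 0 ≤ (ν - 1) * k * p 0 ^ 2 := mul_nonneg (mul_nonneg (by linarith) hk) (sq_nonneg _)
    linarith
  have hνpos : 0 < ν := by linarith
  constructor
  · refine le_of_mul_le_mul_left ?_ hνpos
    exact (hlow y).trans ((energy_le hk hνpos.le hpc hqc hp hq hy).trans h0)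
  · refine le_of_mul_le_mul_left ?_ hνpos
    have hB : 0 ≤ (8 * k / ν) ^ (2 * k) := by positivity
    calc ν * (‖a y‖ ^ 2 * weight k y) = ν * ‖a y‖ ^ 2 * weight k y := by ring
      _ ≤ _ := mul_le_mul_of_nonneg_right (hlow y) (weight_nonneg k y)
      _ ≤ _ := energy_mul_weight_le hk hνpos hpc hqc hp hq hy
      _ ≤ 5 / 2 * (ν * ((1 + 2 * k) * ‖a 0‖ ^ 2) * (8 * k / ν) ^ (2 * k)) := by gcongr
      _ = _ := by ring

/-- The growth `(l + 1)^(2k)` at the origin cancels exactly against the factor `(8k / (l + 1))^(2k)`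
of the weighted estimate. -/
theorem exists_hoFun_bounds {k : ℝ} (hk : 0 ≤ k) : ∃ C : ℝ, 0 < C ∧ ∀ n : ℤ,
    ∀ x ∈ Set.Icc 0 (2 * Real.pi), ‖hoFun k n x‖ ^ 2 ≤ C * (|(n : ℝ)| + 1) ^ (2 * k) ∧
      ‖hoFun k n x‖ ^ 2 * weight k x ≤ C := by
  set A : ℝ := (1 + 2 * k) * (‖hoFun k 1 0‖ ^ 2 * Real.exp (2 * k)) with hA
  set B : ℝ := 5 / 2 * A * (8 * k) ^ (2 * k) with hB
  have hA0 : 0 ≤ A := by positivity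
  have hB0 : 0 ≤ B := by positivity
  have key : ∀ l : ℕ, ∀ x ∈ Set.Icc 0 (2 * Real.pi),
      ‖hoFun k (l + 1) x‖ ^ 2 ≤ A * ((l : ℝ) + 1) ^ (2 * k) ∧
      ‖hoFun k (l + 1) x‖ ^ 2 * weight k x ≤ B := fun l x hx => by
    obtain ⟨h1, h2⟩ := hoFun_pos_bounds hk l hx
    have h3 := norm_hoFun_zero_sq_le hk l
    have hl : (0 : ℝ) < (l : ℝ) + 1 := by positivity
    refine ⟨h1.trans ?_, h2.trans ?_⟩
    · calc _ ≤ (1 + 2 * k) * (‖hoFun k 1 0‖ ^ 2 * Real.exp (2 * k) * ((l : ℝ) + 1) ^ (2 * k)) := by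
            gcongr
        _ = _ := by rw [hA]; ring
    · calc _ ≤ 5 / 2 * (1 + 2 * k)
            * (‖hoFun k 1 0‖ ^ 2 * Real.exp (2 * k) * ((l : ℝ) + 1) ^ (2 * k))
            * (8 * k / (l + 1)) ^ (2 * k) := by gcongr
        _ = B := by
          rw [hB, hA, Real.div_rpow (by positivity) hl.le]
          have : ((l : ℝ) + 1) ^ (2 * k) ≠ 0 := by positivity
          field_simp
  refine ⟨A + B + 1, by positivity, fun n x hx => ?_⟩
  have hpos : 0 ≤ (|(n : ℝ)| + 1) ^ (2 * k) := by positivity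
  obtain ⟨l, hl | hl⟩ := exists_nat_eq_add_one_or_neg n
  · obtain ⟨h1, h2⟩ := key l x hx
    rw [← hl] at h1 h2
    refine ⟨h1.trans ?_, by linarith⟩
    have h3 : ((l : ℝ) + 1) ^ (2 * k) ≤ (|(n : ℝ)| + 1) ^ (2 * k) := by
      refine Real.rpow_le_rpow (by positivity) ?_ (by positivity)
      rw [hl]; push_cast
      linarith [le_abs_self ((l : ℝ) + 1)]
    calc A * ((l : ℝ) + 1) ^ (2 * k) ≤ A * (|(n : ℝ)| + 1) ^ (2 * k) := by gcongr
      _ ≤ _ := by gcongr; linarith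
  · obtain ⟨h1, h2⟩ := key l x hx
    rw [show (l : ℤ) + 1 = 1 - n by omega, norm_hoFun_one_sub hk] at h1 h2
    refine ⟨h1.trans ?_, by linarith⟩
    have h3 : (l : ℝ) = |(n : ℝ)| := by rw [hl]; simp
    rw [h3]
    gcongr
    linarith

/-! ### Integrals against the cosecant of the half angle -/

theorem sin_half_nonneg {x : ℝ} (hx : x ∈ Set.Icc 0 (2 * Real.pi)) : 0 ≤ Real.sin (x / 2) :=
  Real.sin_nonneg_of_nonneg_of_le_pi (by linarith [hx.1]) (by linarith [hx.2])

theorem sin_half_pos {x : ℝ} (hx : x ∈ Set.Ioo 0 (2 * Real.pi)) : 0 < Real.sin (x / 2) :=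
  Real.sin_pos_of_pos_of_lt_pi (by linarith [hx.1]) (by linarith [hx.2])

theorem hasDerivAt_sin_half (x : ℝ) :
    HasDerivAt (fun y => Real.sin (y / 2)) (Real.cos (x / 2) / 2) x := by
  have := (Real.hasDerivAt_sin (x / 2)).comp x ((hasDerivAt_id x).div_const 2)
  exact this.congr_deriv (by ring)

theorem hasDerivAt_cos_half (x : ℝ) :
    HasDerivAt (fun y => Real.cos (y / 2)) (-Real.sin (x / 2) / 2) x := by
  have := (Real.hasDerivAt_cos (x / 2)).comp x ((hasDerivAt_id x).div_const 2)
  exact this.congr_deriv (by ring)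

theorem continuousOn_inv_sin_half_add {ε : ℝ} (hε : 0 < ε) :
    ContinuousOn (fun x => (Real.sin (x / 2) + ε)⁻¹) (Set.Icc 0 (2 * Real.pi)) := by
  refine ContinuousOn.inv₀ (Continuous.continuousOn (by fun_prop)) fun x hx => ?_
  have := sin_half_nonneg hx
  positivity

theorem integral_inv_sq_le {ε : ℝ} (hε : 0 < ε) :
    ∫ x in (0 : ℝ)..(2 * Real.pi), (Real.sin (x / 2) + ε)⁻¹ ^ 2 ≤ 4 / ε := by
  have hpi : (0 : ℝ) ≤ 2 * Real.pi := by positivity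
  have hcont := continuousOn_inv_sin_half_add hε
  have hu : Set.uIcc 0 (2 * Real.pi) = Set.Icc 0 (2 * Real.pi) := Set.uIcc_of_le hpi
  -- The derivative of this function exceeds the integrand by `ε sin(x/2) / (sin(x/2) + ε)²`, and
  -- its total increment is `4 / ε`.
  set f : ℝ → ℝ := fun x => -2 * (Real.cos (x / 2) * (Real.sin (x / 2) + ε)⁻¹) with hf
  set f' : ℝ → ℝ := fun x =>
    (1 + ε * Real.sin (x / 2)) * (Real.sin (x / 2) + ε)⁻¹ ^ 2 with hf'
  have hd : ∀ x ∈ Set.uIcc 0 (2 * Real.pi), HasDerivAt f (f' x) x := fun x hx => by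
    rw [hu] at hx
    have hs := sin_half_nonneg hx
    have hne : Real.sin (x / 2) + ε ≠ 0 := by positivity
    refine ((((hasDerivAt_cos_half x).mul
      (((hasDerivAt_sin_half x).add_const ε).inv hne)).const_mul (-2))).congr_deriv ?_
    have hcs : Real.cos (x / 2) ^ 2 = 1 - Real.sin (x / 2) ^ 2 := by
      linarith [Real.sin_sq_add_cos_sq (x / 2)]
    simp only [hf', Pi.inv_apply]
    field_simp
    rw [hcs]
    ring
  have hi' : ContinuousOn f' (Set.Icc 0 (2 * Real.pi)) :=
    ContinuousOn.mul (Continuous.continuousOn (by fun_prop)) (hcont.pow 2)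
  have h1 := intervalIntegral.integral_eq_sub_of_hasDerivAt hd
    (ContinuousOn.intervalIntegrable (by rwa [hu]))
  have h2 : f (2 * Real.pi) - f 0 = 4 / ε := by
    have : 2 * Real.pi / 2 = Real.pi := by ring
    simp only [hf, this, Real.cos_pi, Real.sin_pi, zero_div, Real.cos_zero, Real.sin_zero]
    field_simp
    ring
  rw [← h2, ← h1]
  refine intervalIntegral.integral_mono_on hpi
    (ContinuousOn.intervalIntegrable (by rw [hu]; exact hcont.pow 2))
    (ContinuousOn.intervalIntegrable (by rwa [hu])) fun x hx => ?_
  have hs := sin_half_nonneg hx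
  simp only [hf']
  have : 0 ≤ (Real.sin (x / 2) + ε)⁻¹ ^ 2 := by positivity
  nlinarith [mul_nonneg (mul_nonneg hε.le hs) this]

/-- The density controlling the difference of the cosecant and its regularization. -/
noncomputable def cosecDefect (k ε x : ℝ) : ℝ :=
  (Real.sin (x / 2) / (Real.sin (x / 2) + ε)) ^ (2 * k)
    * (ε / (Real.sin (x / 2) * (Real.sin (x / 2) + ε)))

theorem cosecDefect_integral_le {k ε : ℝ} (hk : 0 < k) (hε : 0 < ε) :
    IntervalIntegrable (cosecDefect k ε) MeasureTheory.volume 0 (2 * Real.pi) ∧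
    ∫ x in (0 : ℝ)..(2 * Real.pi), cosecDefect k ε x ≤ 2 * Real.pi * (1 / (2 * k) + ε) := by
  have hpi : (0 : ℝ) ≤ 2 * Real.pi := by positivity
  set s : ℝ → ℝ := fun x => Real.sin (x / 2) with hs
  set g : ℝ → ℝ := fun x => (s x / (s x + ε)) ^ (2 * k) with hg
  -- The derivative of `g` is `k cos(x/2)` times the defect. The extra factor `cos(x/2)` makes the
  -- sign positive on both halves of the period, and the linear term pays for `sin² = 1 - cos²` and
  -- for the derivative of that factor.
  set f : ℝ → ℝ := fun x => Real.cos (x / 2) * g x + (1 / 2 + k * ε) * x with hf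
  set f' : ℝ → ℝ := fun x => -s x / 2 * g x
    + Real.cos (x / 2) * (Real.cos (x / 2) * k * cosecDefect k ε x) + (1 / 2 + k * ε) with hf'
  have hsc : Continuous s := by fun_prop
  have hgc : ContinuousOn g (Set.Icc 0 (2 * Real.pi)) := by
    refine ContinuousOn.rpow_const ?_ (fun x _ => Or.inr (by positivity))
    exact hsc.continuousOn.mul (continuousOn_inv_sin_half_add hε)
  have hfc : ContinuousOn f (Set.Icc 0 (2 * Real.pi)) :=
    (ContinuousOn.mul (Continuous.continuousOn (by fun_prop)) hgc).add
      (Continuous.continuousOn (by fun_prop))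
  have hd : ∀ x ∈ Set.Ioo 0 (2 * Real.pi), HasDerivAt f (f' x) x := fun x hx => by
    have h0 : 0 < s x := sin_half_pos hx
    have hne : s x + ε ≠ 0 := by positivity
    have hne0 : s x / (s x + ε) ≠ 0 := by positivity
    have h1 := (((hasDerivAt_sin_half x).div ((hasDerivAt_sin_half x).add_const ε) hne).rpow_const
      (p := 2 * k) (Or.inl hne0))
    refine (((hasDerivAt_cos_half x).mul h1).add
      ((hasDerivAt_id x).const_mul (1 / 2 + k * ε))).congr_deriv ?_
    simp only [hf', cosecDefect, hg, Pi.div_apply]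
    rw [Real.rpow_sub_one hne0]
    change _ + Real.cos (x / 2) * ((Real.cos (x / 2) / 2 * (s x + ε) - s x * (Real.cos (x / 2) / 2))
      / (s x + ε) ^ 2 * (2 * k) * ((s x / (s x + ε)) ^ (2 * k) / (s x / (s x + ε)))) + _ =
      _ + _ * (_ * ((s x / (s x + ε)) ^ (2 * k) * (ε / (s x * (s x + ε))))) + _
    change -s x / 2 * (s x / (s x + ε)) ^ (2 * k) + _ + _ = _
    generalize (s x / (s x + ε)) ^ (2 * k) = G
    field_simp
    ring
  have hlow : ∀ x ∈ Set.Ioo 0 (2 * Real.pi),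
      0 ≤ cosecDefect k ε x ∧ k * cosecDefect k ε x ≤ f' x := fun x hx => by
    have h0 : 0 < s x := sin_half_pos hx
    have h1 : s x ≤ 1 := Real.sin_le_one _
    have hg0 : 0 ≤ g x := by positivity
    have hg1 : g x ≤ 1 :=
      Real.rpow_le_one (by positivity) ((div_le_one (by positivity)).mpr (by linarith))
        (by positivity)
    have hW : s x ^ 2 * cosecDefect k ε x = g x * (s x / (s x + ε)) * ε := by
      change s x ^ 2 * (g x * (ε / (s x * (s x + ε)))) = _
      field_simp
    have hr : s x / (s x + ε) ≤ 1 := (div_le_one (by positivity)).mpr (by linarith)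
    have hW1 : s x ^ 2 * cosecDefect k ε x ≤ ε := by
      rw [hW]
      have : g x * (s x / (s x + ε)) ≤ 1 := mul_le_one₀ hg1 (by positivity) hr
      nlinarith
    have hcs : Real.cos (x / 2) ^ 2 = 1 - s x ^ 2 := by
      linarith [Real.sin_sq_add_cos_sq (x / 2)]
    have hsg : s x * g x ≤ 1 := mul_le_one₀ h1 hg0 hg1
    refine ⟨?_, ?_⟩
    · change 0 ≤ g x * (ε / (s x * (s x + ε)))
      positivity
    · have : f' x = k * cosecDefect k ε x + (1 - s x * g x) / 2
          + k * (ε - s x ^ 2 * cosecDefect k ε x) := by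
        simp only [hf']
        linear_combination (k * cosecDefect k ε x) * hcs
      rw [this]
      have := mul_nonneg hk.le (sub_nonneg.mpr hW1)
      linarith
  have hfi : IntervalIntegrable f' MeasureTheory.volume 0 (2 * Real.pi) := by
    rw [intervalIntegrable_iff_integrableOn_Ioc_of_le hpi]
    refine intervalIntegral.integrableOn_deriv_of_nonneg hfc hd fun x hx => ?_
    have := hlow x hx
    nlinarith [mul_nonneg hk.le this.1]
  have hmeas : Measurable (cosecDefect k ε) := by unfold cosecDefect; fun_prop
  have hki : IntervalIntegrable (fun x => k * cosecDefect k ε x) MeasureTheory.volume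
      0 (2 * Real.pi) := by
    rw [intervalIntegrable_iff_integrableOn_Ioo_of_le hpi] at hfi ⊢
    refine MeasureTheory.Integrable.mono' hfi (hmeas.const_mul k).aestronglyMeasurable ?_
    rw [MeasureTheory.ae_restrict_iff' measurableSet_Ioo]
    refine Filter.Eventually.of_forall fun x hx => ?_
    rw [Real.norm_of_nonneg (mul_nonneg hk.le (hlow x hx).1)]
    exact (hlow x hx).2
  have hWi : IntervalIntegrable (cosecDefect k ε) MeasureTheory.volume 0 (2 * Real.pi) := by
    refine (hki.const_mul k⁻¹).congr fun x _ => ?_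
    field_simp
  refine ⟨hWi, ?_⟩
  have h1 := intervalIntegral.integral_eq_sub_of_hasDerivAt_of_le hpi hfc hd hfi
  have h2 : f (2 * Real.pi) - f 0 = (1 / 2 + k * ε) * (2 * Real.pi) := by
    have h3 : 2 * Real.pi / 2 = Real.pi := by ring
    have h4 : (2 * k) ≠ 0 := by positivity
    simp only [hf, hg, hs, h3, Real.sin_pi, zero_div, Real.sin_zero, Real.zero_rpow h4]
    ring
  have h3 : ∫ x in (0 : ℝ)..(2 * Real.pi), k * cosecDefect k ε x
      ≤ ∫ x in (0 : ℝ)..(2 * Real.pi), f' x :=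
    intervalIntegral.integral_mono_on_of_le_Ioo hpi hki hfi fun x hx => (hlow x hx).2
  rw [intervalIntegral.integral_const_mul, h1, h2] at h3
  refine le_of_mul_le_mul_left (h3.trans_eq ?_) hk
  field_simp

/-- The product of two normalized polynomials and the weight. -/
noncomputable def hoProd (k : ℝ) (n m : ℤ) (x : ℝ) : ℂ :=
  hoFun k m x * (starRingEnd ℂ) (hoFun k n x) * (weight k x : ℂ)

theorem continuous_hoProd {k : ℝ} (hk : 0 ≤ k) (n m : ℤ) : Continuous (hoProd k n m) := by
  have h1 := (cherednikEigen_hoFun hk m).cont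
  have h2 := (cherednikEigen_hoFun hk n).cont_conj
  have h3 := continuous_weight hk
  unfold hoProd
  fun_prop

theorem weight_le_sin_half {k x : ℝ} (hk : 0 ≤ k) (hx : x ∈ Set.Icc 0 (2 * Real.pi)) :
    weight k x ≤ (4 * Real.sin (x / 2)) ^ (2 * k) := by
  refine Real.rpow_le_rpow (abs_nonneg _) ?_ (by positivity)
  have h0 := sin_half_nonneg hx
  have h1 : Real.sin x = 2 * Real.sin (x / 2) * Real.cos (x / 2) := by
    rw [← Real.sin_two_mul]; ring_nf
  rw [h1, abs_mul, abs_mul, abs_mul, abs_two, abs_of_nonneg h0]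
  nlinarith [Real.abs_cos_le_one (x / 2)]

/-- The second bound records the vanishing of the weight at `0` and `2π`, where the polynomials are
only of size `N^k`. It interpolates between `(sin(x/2) N)^(2k)` and a constant. -/
theorem exists_norm_hoProd_le {k : ℝ} (hk : 0 ≤ k) : ∃ C : ℝ, 0 < C ∧ ∀ n m : ℤ,
    ∀ x ∈ Set.Icc 0 (2 * Real.pi), ‖hoProd k n m x‖ ≤ C ∧
      ∀ N : ℝ, |(n : ℝ)| + 1 ≤ N → |(m : ℝ)| + 1 ≤ N → ‖hoProd k n m x‖
        ≤ C * (Real.sin (x / 2) / (Real.sin (x / 2) + N⁻¹)) ^ (2 * k) := by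
  obtain ⟨C, hC, h⟩ := exists_hoFun_bounds hk
  have h8 : (1 : ℝ) ≤ 8 ^ (2 * k) := Real.one_le_rpow (by norm_num) (by positivity)
  -- With `s = sin(x/2)`, the near region `s ≤ 1/N` uses `4sN (s + 1/N) ≤ 8s`; the far region only
  -- needs `s + 1/N ≤ 8s`.
  refine ⟨C * 8 ^ (2 * k), by positivity, fun n m x hx => ?_⟩
  obtain ⟨hn1, hn2⟩ := h n x hx
  obtain ⟨hm1, hm2⟩ := h m x hx
  have hw := weight_nonneg k x
  have hnorm : ‖hoProd k n m x‖ = ‖hoFun k m x‖ * ‖hoFun k n x‖ * weight k x := by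
    rw [hoProd, norm_mul, norm_mul, Complex.norm_conj, Complex.norm_real,
      Real.norm_of_nonneg hw]
  have hamgm : ‖hoFun k m x‖ * ‖hoFun k n x‖
      ≤ (‖hoFun k m x‖ ^ 2 + ‖hoFun k n x‖ ^ 2) / 2 := by
    nlinarith [sq_nonneg (‖hoFun k m x‖ - ‖hoFun k n x‖)]
  have hP : ‖hoProd k n m x‖ ≤ C := by
    rw [hnorm]
    calc _ ≤ (‖hoFun k m x‖ ^ 2 + ‖hoFun k n x‖ ^ 2) / 2 * weight k x := by gcongr
      _ ≤ C := by linarith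
  refine ⟨hP.trans (le_mul_of_one_le_right hC.le h8), fun N hnN hmN => ?_⟩
  have hN : 0 < N := by linarith [abs_nonneg (n : ℝ)]
  have hs := sin_half_nonneg hx
  set s := Real.sin (x / 2) with hsdef
  have hden : 0 < s + N⁻¹ := by positivity
  have hmono : ∀ j : ℤ, |(j : ℝ)| + 1 ≤ N → (|(j : ℝ)| + 1) ^ (2 * k) ≤ N ^ (2 * k) :=
    fun j hj => Real.rpow_le_rpow (by positivity) hj (by positivity)
  have hP2 : ‖hoProd k n m x‖ ≤ C * (4 * (s * N)) ^ (2 * k) := by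
    rw [hnorm]
    calc _ ≤ (‖hoFun k m x‖ ^ 2 + ‖hoFun k n x‖ ^ 2) / 2 * weight k x := by gcongr
      _ ≤ (C * N ^ (2 * k) + C * N ^ (2 * k)) / 2 * (4 * s) ^ (2 * k) := by
        have hwl := weight_le_sin_half hk hx
        gcongr
        · exact hm1.trans (mul_le_mul_of_nonneg_left (hmono m hmN) hC.le)
        · exact hn1.trans (mul_le_mul_of_nonneg_left (hmono n hnN) hC.le)
      _ = _ := by
        rw [← mul_assoc 4, Real.mul_rpow (by positivity) hN.le]
        ring
  rw [mul_assoc, ← Real.mul_rpow (by norm_num) (by positivity)]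
  rcases le_total s N⁻¹ with hsN | hsN
  · refine hP2.trans (mul_le_mul_of_nonneg_left
      (Real.rpow_le_rpow (by positivity) ?_ (by positivity)) hC.le)
    rw [mul_div_assoc', le_div_iff₀ hden]
    have : s * N ≤ 1 := by
      calc s * N ≤ N⁻¹ * N := by gcongr
        _ = 1 := inv_mul_cancel₀ hN.ne'
    have h2 : 4 * (s * N) * (s + N⁻¹) = 4 * s * (s * N) + 4 * s * (N * N⁻¹) := by ring
    rw [h2, mul_inv_cancel₀ hN.ne']
    nlinarith
  · refine hP.trans (le_mul_of_one_le_right hC.le (Real.one_le_rpow ?_ (by positivity)))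
    rw [mul_div_assoc', le_div_iff₀ hden]
    linarith

/-- The regularized cosecant is symmetric about `π`, so one integration by parts trades the spectral
gap for the integral of its derivative, which is `O(N)` by `integral_inv_sq_le`. -/
theorem exists_regularized_cosec_bound {k : ℝ} (hk : 0 ≤ k) : ∃ C : ℝ, 0 < C ∧ ∀ n m : ℤ,
    ∀ N : ℝ, 0 < N → |eigenvalue k m - eigenvalue k n| *
      ‖∫ x in (0 : ℝ)..(2 * Real.pi), ((Real.sin (x / 2) + N⁻¹)⁻¹ : ℝ) * hoProd k n m x‖
        ≤ C * N := by
  obtain ⟨C, hC, h⟩ := exists_norm_hoProd_le hk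
  refine ⟨2 * C, by positivity, fun n m N hN => ?_⟩
  have hpi : (0 : ℝ) ≤ 2 * Real.pi := by positivity
  have hu : Set.uIcc 0 (2 * Real.pi) = Set.Icc 0 (2 * Real.pi) := Set.uIcc_of_le hpi
  have hε : 0 < N⁻¹ := by positivity
  have hc := continuousOn_inv_sin_half_add hε
  set φ : ℝ → ℝ := fun x => (Real.sin (x / 2) + N⁻¹)⁻¹ with hφ
  set φ' : ℝ → ℝ := fun x => -(Real.cos (x / 2) / 2) * φ x ^ 2 with hφ'
  have hc' : ContinuousOn φ' (Set.Icc 0 (2 * Real.pi)) :=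
    ContinuousOn.mul (Continuous.continuousOn (by fun_prop)) (hc.pow 2)
  have key := (cherednikEigen_hoFun hk m).integral_by_parts_of_symm hk
    (cherednikEigen_hoFun hk n) (φ := fun x => (φ x : ℂ)) (φ' := fun x => (φ' x : ℂ))
    (Complex.continuous_ofReal.comp_continuousOn hc)
    (fun x hx => by
      have hs := sin_half_pos hx
      refine (((hasDerivAt_sin_half x).add_const N⁻¹).inv (by positivity)).ofReal_comp.congr_deriv ?_
      simp only [hφ', hφ]
      congr 1
      field_simp)
    (Complex.continuous_ofReal.comp_continuousOn hc')
    (fun x => by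
      simp only [hφ]
      rw [show (2 * Real.pi - x) / 2 = Real.pi - x / 2 by ring, Real.sin_pi_sub])
  change (∫ x in (0 : ℝ)..(2 * Real.pi), (φ' x : ℂ) * hoProd k n m x) + _ *
    (∫ x in (0 : ℝ)..(2 * Real.pi), (φ x : ℂ) * hoProd k n m x) = 0 at key
  have hle : ‖∫ x in (0 : ℝ)..(2 * Real.pi), (φ' x : ℂ) * hoProd k n m x‖ ≤ 2 * C * N := by
    have h1 : ‖∫ x in (0 : ℝ)..(2 * Real.pi), (φ' x : ℂ) * hoProd k n m x‖
        ≤ ∫ x in (0 : ℝ)..(2 * Real.pi), C / 2 * φ x ^ 2 := by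
      refine intervalIntegral.norm_integral_le_of_norm_le hpi
        (Filter.Eventually.of_forall fun x hx => ?_)
        (ContinuousOn.intervalIntegrable (by rw [hu]; exact continuousOn_const.mul (hc.pow 2)))
      have hP := (h n m x (Set.Ioc_subset_Icc_self hx)).1
      rw [norm_mul, Complex.norm_real, Real.norm_eq_abs, abs_mul, abs_neg, abs_div, abs_two,
        abs_of_nonneg (sq_nonneg (φ x))]
      have h2 := Real.abs_cos_le_one (x / 2)
      calc |Real.cos (x / 2)| / 2 * φ x ^ 2 * ‖hoProd k n m x‖ ≤ 1 / 2 * φ x ^ 2 * C := by gcongr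
        _ = _ := by ring
    rw [intervalIntegral.integral_const_mul] at h1
    have h2 := integral_inv_sq_le hε
    calc _ ≤ _ := h1
      _ ≤ C / 2 * (4 / N⁻¹) := by gcongr
      _ = _ := by rw [div_inv_eq_mul]; ring
  have hn := congrArg norm (eq_neg_of_add_eq_zero_right key)
  rw [norm_neg, norm_mul, norm_mul, Complex.norm_I, one_mul, ← Complex.ofReal_sub,
    Complex.norm_real, Real.norm_eq_abs] at hn
  rw [hn]
  exact hle

/-- The error of regularizing at `ε = 1/N` is dominated by `cosecDefect`, whose integral is bounded
independently of `N`. Strict positivity of `k` makes the cosecant integrable against the product. -/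
theorem exists_cosec_bound {k : ℝ} (hk : 0 < k) : ∃ C : ℝ, 0 < C ∧ ∀ n m : ℤ,
    ∀ N : ℝ, |(n : ℝ)| + 1 ≤ N → |(m : ℝ)| + 1 ≤ N → |eigenvalue k m - eigenvalue k n| *
      ‖∫ x in (0 : ℝ)..(2 * Real.pi), ((Real.sin (x / 2))⁻¹ : ℝ) * hoProd k n m x‖
        ≤ C * (N + |eigenvalue k m - eigenvalue k n|) := by
  obtain ⟨C, hC, h⟩ := exists_norm_hoProd_le hk.le
  obtain ⟨D, hD, h'⟩ := exists_regularized_cosec_bound hk.le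
  set B := C * (2 * Real.pi * (1 / (2 * k) + 1)) with hB
  have hBpos : 0 < B := by positivity
  refine ⟨D + B, by positivity, fun n m N hn hm => ?_⟩
  have hN1 : 1 ≤ N := by linarith [abs_nonneg (n : ℝ)]
  have hN : 0 < N := by linarith
  have hpi : (0 : ℝ) ≤ 2 * Real.pi := by positivity
  have hu : Set.uIcc 0 (2 * Real.pi) = Set.Icc 0 (2 * Real.pi) := Set.uIcc_of_le hpi
  have hε : 0 < N⁻¹ := by positivity
  have hε1 : N⁻¹ ≤ 1 := inv_le_one_of_one_le₀ hN1
  obtain ⟨hW1, hW2⟩ := cosecDefect_integral_le hk hε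
  set P := hoProd k n m with hP
  have hPc : Continuous P := continuous_hoProd hk.le n m
  set r : ℝ → ℝ := fun x =>
    N⁻¹ / (Real.sin (x / 2) * (Real.sin (x / 2) + N⁻¹)) with hr
  have hrm : Measurable r := by fun_prop
  have hle : ∀ x ∈ Set.Ioo 0 (2 * Real.pi), ‖(r x : ℂ) * P x‖ ≤ C * cosecDefect k N⁻¹ x :=
    fun x hx => by
    have hs := sin_half_pos hx
    have h1 := (h n m x (Set.Ioo_subset_Icc_self hx)).2 N hn hm
    have hr0 : 0 ≤ r x := by simp only [hr]; positivity
    rw [norm_mul, Complex.norm_real, Real.norm_of_nonneg hr0]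
    calc r x * ‖P x‖ ≤ r x * (C * (Real.sin (x / 2) / (Real.sin (x / 2) + N⁻¹)) ^ (2 * k)) := by
          gcongr
      _ = _ := by rw [cosecDefect]; ring
  have hCW : IntervalIntegrable (fun x => C * cosecDefect k N⁻¹ x) MeasureTheory.volume
      0 (2 * Real.pi) := hW1.const_mul C
  have hri : IntervalIntegrable (fun x => (r x : ℂ) * P x) MeasureTheory.volume
      0 (2 * Real.pi) := by
    rw [intervalIntegrable_iff_integrableOn_Ioo_of_le hpi] at hCW ⊢
    refine MeasureTheory.Integrable.mono' hCW
      ((Complex.measurable_ofReal.comp hrm).mul hPc.measurable).aestronglyMeasurable ?_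
    rw [MeasureTheory.ae_restrict_iff' measurableSet_Ioo]
    exact Filter.Eventually.of_forall hle
  have hφi : IntervalIntegrable (fun x => ((Real.sin (x / 2) + N⁻¹)⁻¹ : ℝ) * P x)
      MeasureTheory.volume 0 (2 * Real.pi) :=
    ContinuousOn.intervalIntegrable (by
      rw [hu]
      exact (Complex.continuous_ofReal.comp_continuousOn
        (continuousOn_inv_sin_half_add hε)).mul hPc.continuousOn)
  have hsplit : ∫ x in (0 : ℝ)..(2 * Real.pi), ((Real.sin (x / 2))⁻¹ : ℝ) * P x
      = (∫ x in (0 : ℝ)..(2 * Real.pi), ((Real.sin (x / 2) + N⁻¹)⁻¹ : ℝ) * P x)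
        + ∫ x in (0 : ℝ)..(2 * Real.pi), (r x : ℂ) * P x := by
    rw [← intervalIntegral.integral_add hφi hri]
    refine intervalIntegral.integral_congr_Ioo_of_le hpi fun x hx => ?_
    have hs := sin_half_pos hx
    rw [← add_mul, ← Complex.ofReal_add]
    congr 2
    simp only [hr]
    field_simp
  have hrle : ‖∫ x in (0 : ℝ)..(2 * Real.pi), (r x : ℂ) * P x‖ ≤ B := by
    have h1 : ∫ x in (0 : ℝ)..(2 * Real.pi), ‖(r x : ℂ) * P x‖
        ≤ ∫ x in (0 : ℝ)..(2 * Real.pi), C * cosecDefect k N⁻¹ x :=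
      intervalIntegral.integral_mono_on_of_le_Ioo hpi hri.norm hCW hle
    rw [intervalIntegral.integral_const_mul] at h1
    refine (intervalIntegral.norm_integral_le_integral_norm hpi).trans (h1.trans ?_)
    rw [hB]
    refine mul_le_mul_of_nonneg_left (hW2.trans ?_) hC.le
    gcongr
  have h3 := h' n m N hN
  rw [← hP] at h3
  rw [hsplit]
  set L := |eigenvalue k m - eigenvalue k n|
  have hL : 0 ≤ L := abs_nonneg _
  calc L * ‖_ + _‖ ≤ L * (‖∫ x in (0 : ℝ)..(2 * Real.pi),
          ((Real.sin (x / 2) + N⁻¹)⁻¹ : ℝ) * P x‖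
          + ‖∫ x in (0 : ℝ)..(2 * Real.pi), (r x : ℂ) * P x‖) := by gcongr; exact norm_add_le _ _
    _ ≤ D * N + L * B := by rw [mul_add]; gcongr
    _ ≤ (D + B) * (N + L) := by nlinarith [mul_nonneg hD.le hL, mul_nonneg hBpos.le hN.le]

/-! ### Decay of the Riesz integral -/

/-- The integral defining the Riesz kernel, without the prefactor. -/
noncomputable def rieszInt (k : ℝ) (n m : ℤ) : ℂ :=
  ∫ x in (0 : ℝ)..(2 * Real.pi), Complex.exp (-(Complex.I * x / 2)) * hoProd k n m x

theorem rieszKernel_eq {k : ℝ} (hk : 0 ≤ k) (n m : ℤ) :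
    rieszKernel k n m = (1 / (2 * Real.pi * Complex.I) : ℂ) * rieszInt k n m := by
  unfold rieszKernel rieszInt
  congr 1
  refine intervalIntegral.integral_congr fun x _ => ?_
  simp only [hoNormalized_neg hk, hoProd]
  change _ * hoFun k m x * _ * _ = _
  ring

theorem exp_neg_half_eq (x : ℝ) : Complex.exp (-(Complex.I * x / 2))
    = (Real.cos (x / 2) : ℂ) - Complex.I * (Real.sin (x / 2) : ℂ) := by
  rw [show -(Complex.I * x / 2) = ((-(x / 2) : ℝ) : ℂ) * Complex.I by push_cast; ring,
    Complex.exp_mul_I, ← Complex.ofReal_cos, ← Complex.ofReal_sin, Real.cos_neg, Real.sin_neg]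
  push_cast
  ring

/-- Integration by parts with `φ = e^{-ix/2}`. Here `φ(x) - φ(2π - x) = 2 cos(x/2)`, which against
`sin x = 2 sin(x/2) cos(x/2)` leaves the cosecant, and `e^{ix} conj 𝓔_m = 𝓔_{1-m}`. The `-1/2` comes
from differentiating `φ`. -/
theorem rieszInt_eq {k : ℝ} (hk : 0 ≤ k) (n m : ℤ) :
    -2 * hoProd k n m 0
      = Complex.I * (eigenvalue k m - eigenvalue k n - 1 / 2) * rieszInt k n m
        + k * ∫ x in (0 : ℝ)..(2 * Real.pi),
          ((Real.sin (x / 2))⁻¹ : ℝ) * hoProd k n (1 - m) x := by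
  have hpi : (0 : ℝ) ≤ 2 * Real.pi := by positivity
  have hd : ∀ x : ℝ, HasDerivAt (fun y : ℝ => Complex.exp (-(Complex.I * y / 2)))
      (-(Complex.I / 2) * Complex.exp (-(Complex.I * x / 2))) x := fun x => by
    have h1 : HasDerivAt (fun y : ℝ => -(Complex.I * (y : ℂ) / 2)) (-(Complex.I * 1 / 2)) x :=
      (((Complex.ofRealCLM.hasDerivAt (x := x)).const_mul Complex.I).div_const 2).neg
    refine h1.cexp.congr_deriv ?_
    ring
  have key := (cherednikEigen_hoFun hk m).integral_by_parts hk (cherednikEigen_hoFun hk n)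
    (φ := fun x : ℝ => Complex.exp (-(Complex.I * x / 2)))
    (φ' := fun x : ℝ => -(Complex.I / 2) * Complex.exp (-(Complex.I * x / 2)))
    (Continuous.continuousOn (by fun_prop)) (fun x _ => hd x)
    (Continuous.continuousOn (by fun_prop))
  have e1 : Complex.exp (-(Complex.I * (2 * Real.pi : ℝ) / 2))
      - Complex.exp (-(Complex.I * (0 : ℝ) / 2)) = -2 := by
    rw [exp_neg_half_eq, exp_neg_half_eq, mul_div_cancel_left₀ _ two_ne_zero]
    simp
    norm_num
  have e2 : ∫ x in (0 : ℝ)..(2 * Real.pi), (-(Complex.I / 2) *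
      Complex.exp (-(Complex.I * x / 2))) * hoProd k n m x
      = -(Complex.I / 2) * rieszInt k n m := by
    rw [rieszInt, ← intervalIntegral.integral_const_mul]
    exact intervalIntegral.integral_congr fun x _ => by ring
  have e3 : ∫ x in (0 : ℝ)..(2 * Real.pi), (Complex.exp (-(Complex.I * x / 2))
        - Complex.exp (-(Complex.I * (2 * Real.pi - x : ℝ) / 2)))
      * ((k * weight k x / Real.sin x : ℝ) * (Complex.exp (Complex.I * x)
        * (starRingEnd ℂ) (hoFun k m x) * (starRingEnd ℂ) (hoFun k n x)))
      = k * ∫ x in (0 : ℝ)..(2 * Real.pi),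
          ((Real.sin (x / 2))⁻¹ : ℝ) * hoProd k n (1 - m) x := by
    rw [← intervalIntegral.integral_const_mul]
    refine intervalIntegral.integral_congr_ae ?_
    have hae : ∀ᵐ x : ℝ, x ∉ ({Real.pi, 2 * Real.pi} : Set ℝ) :=
      Set.Countable.ae_notMem (Set.toFinite _).countable _
    filter_upwards [hae] with x hx hxm
    rw [Set.uIoc_of_le hpi] at hxm
    simp only [Set.mem_insert_iff, Set.mem_singleton_iff, not_or] at hx
    have hs : (Real.sin (x / 2) : ℂ) ≠ 0 := by
      exact_mod_cast (sin_half_pos ⟨hxm.1, lt_of_le_of_ne hxm.2 hx.2⟩).ne'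
    have hc : (Real.cos (x / 2) : ℂ) ≠ 0 := by
      have : Real.cos (x / 2) ≠ 0 := by
        rcases lt_or_gt_of_ne hx.1 with h | h
        · exact (Real.cos_pos_of_mem_Ioo
            ⟨by linarith [hxm.1, Real.pi_pos], by linarith⟩).ne'
        · exact (Real.cos_neg_of_pi_div_two_lt_of_lt (by linarith)
            (by linarith [hxm.2, Real.pi_pos])).ne
      exact_mod_cast this
    have h1 : Real.sin x = 2 * Real.sin (x / 2) * Real.cos (x / 2) := by
      rw [← Real.sin_two_mul]; ring_nf
    rw [exp_neg_half_eq, exp_neg_half_eq, show (2 * Real.pi - x) / 2 = Real.pi - x / 2 by ring,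
      Real.sin_pi_sub, Real.cos_pi_sub, h1, hoProd, hoFun_one_sub hk]
    simp only [Complex.ofReal_div, Complex.ofReal_mul, Complex.ofReal_neg, Complex.ofReal_inv,
      Complex.ofReal_ofNat]
    field_simp
    ring
  rw [e1] at key
  rw [e3] at key
  change -2 * hoProd k n m 0 = (∫ x in (0 : ℝ)..(2 * Real.pi), (-(Complex.I / 2) *
      Complex.exp (-(Complex.I * x / 2))) * hoProd k n m x) + _ * rieszInt k n m + _ at key
  rw [e2] at key
  rw [key]
  ring

theorem exists_rieszInt_mul_le {k : ℝ} (hk : 0 ≤ k) : ∃ C : ℝ, 0 < C ∧ ∀ n m : ℤ,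
    |eigenvalue k m - eigenvalue k n - 1 / 2| * |1 - eigenvalue k m - eigenvalue k n|
      * ‖rieszInt k n m‖ ≤ C * (|(n : ℝ)| + |(m : ℝ)| + 2) := by
  obtain ⟨A, hA, hP⟩ := exists_norm_hoProd_le hk
  obtain ⟨B, hB, hQ⟩ : ∃ B : ℝ, 0 < B ∧ ∀ n m : ℤ, |1 - eigenvalue k m - eigenvalue k n| *
      ‖k * ∫ x in (0 : ℝ)..(2 * Real.pi), ((Real.sin (x / 2))⁻¹ : ℝ) * hoProd k n (1 - m) x‖
        ≤ B * ((|(n : ℝ)| + |(m : ℝ)| + 2) + |1 - eigenvalue k m - eigenvalue k n|) := by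
    -- For `k = 0` the cosecant estimate is not available, but its prefactor vanishes.
    rcases hk.eq_or_lt with rfl | hk0
    · refine ⟨1, one_pos, fun n m => ?_⟩
      rw [Complex.ofReal_zero, zero_mul, norm_zero, mul_zero]
      positivity
    · obtain ⟨B, hB, h⟩ := exists_cosec_bound hk0
      refine ⟨k * B, by positivity, fun n m => ?_⟩
      have h1 := h n (1 - m) (|(n : ℝ)| + |(m : ℝ)| + 2) (by linarith [abs_nonneg (m : ℝ)]) (by
        push_cast
        have := abs_sub (1 : ℝ) m
        rw [abs_one] at this
        linarith [abs_nonneg (n : ℝ)])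
      rw [eigenvalue_one_sub] at h1
      rw [norm_mul, Complex.norm_real, Real.norm_of_nonneg hk, mul_left_comm, mul_assoc]
      exact mul_le_mul_of_nonneg_left h1 hk
  refine ⟨(2 * A + B) * (2 + 2 * k), by positivity, fun n m => ?_⟩
  have h1 := rieszInt_eq hk n m
  have h2 := (hP n m 0 ⟨le_rfl, by positivity⟩).1
  have h3 := hQ n m
  set N : ℝ := |(n : ℝ)| + |(m : ℝ)| + 2 with hN
  have hN2 : 2 ≤ N := by rw [hN]; linarith [abs_nonneg (n : ℝ), abs_nonneg (m : ℝ)]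
  set Z : ℂ := k * ∫ x in (0 : ℝ)..(2 * Real.pi),
    ((Real.sin (x / 2))⁻¹ : ℝ) * hoProd k n (1 - m) x with hZ
  set L := |1 - eigenvalue k m - eigenvalue k n| with hL
  have hL0 : 0 ≤ L := abs_nonneg _
  have hLN : L ≤ (1 + 2 * k) * N := by
    have he : ∀ j : ℤ, |eigenvalue k j| ≤ |(j : ℝ)| + k := fun j => by
      unfold eigenvalue
      split_ifs
      · exact (abs_add_le _ _).trans (by rw [abs_of_nonneg hk])
      · exact (abs_sub _ _).trans (by rw [abs_of_nonneg hk])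
    have h4 : L ≤ |1 - eigenvalue k m| + |eigenvalue k n| := abs_sub _ _
    have h5 : |1 - eigenvalue k m| ≤ |(1 : ℝ)| + |eigenvalue k m| := abs_sub _ _
    rw [abs_one] at h5
    have h6 := he m
    have h7 := he n
    nlinarith
  have h4 : |eigenvalue k m - eigenvalue k n - 1 / 2| * ‖rieszInt k n m‖ ≤ 2 * A + ‖Z‖ := by
    have h5 : Complex.I * ((eigenvalue k m - eigenvalue k n - 1 / 2 : ℝ) : ℂ) * rieszInt k n m
        = -2 * hoProd k n m 0 - Z := by
      push_cast
      linear_combination -h1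
    have h6 := congrArg norm h5
    rw [norm_mul, norm_mul, Complex.norm_I, one_mul, Complex.norm_real, Real.norm_eq_abs] at h6
    rw [h6]
    refine (norm_sub_le _ _).trans ?_
    rw [norm_mul, norm_neg, Complex.norm_ofNat]
    linarith
  calc _ = L * (|eigenvalue k m - eigenvalue k n - 1 / 2| * ‖rieszInt k n m‖) := by ring
    _ ≤ L * (2 * A + ‖Z‖) := by gcongr
    _ ≤ 2 * A * L + B * (N + L) := by linarith
    _ ≤ 2 * A * ((1 + 2 * k) * N) + B * (N + (1 + 2 * k) * N) := by gcongr
    _ ≤ _ := by nlinarith [mul_nonneg hA.le (by linarith : 0 ≤ N)]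

/-- If both indices are positive or both nonpositive, the second factor is the large one; otherwise
it is the first. The assumption that the distance is at least `2` absorbs the offsets `1/2` and `1`.
-/
theorem eigenvalue_gap {k : ℝ} (hk : 0 ≤ k) {n m : ℤ} (hd : 2 ≤ |(|(m : ℝ)| - |(n : ℝ)|)|) :
    (|(n : ℝ)| + |(m : ℝ)| + 2) * |(|(m : ℝ)| - |(n : ℝ)|)| / 8
      ≤ |eigenvalue k m - eigenvalue k n - 1 / 2| * |1 - eigenvalue k m - eigenvalue k n| := by
  have aux : ∀ {u v : ℝ}, (|(n : ℝ)| + |(m : ℝ)| + 2) / 4 ≤ u →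
      |(|(m : ℝ)| - |(n : ℝ)|)| / 2 ≤ v →
      (|(n : ℝ)| + |(m : ℝ)| + 2) * |(|(m : ℝ)| - |(n : ℝ)|)| / 8 ≤ u * v := fun {u v} hu hv => by
    have hu0 : 0 ≤ u := le_trans (by positivity) hu
    calc _ = (|(n : ℝ)| + |(m : ℝ)| + 2) / 4 * (|(|(m : ℝ)| - |(n : ℝ)|)| / 2) := by ring
      _ ≤ u * v := by gcongr
  have hsum : |(|(m : ℝ)| - |(n : ℝ)|)| ≤ |(m : ℝ)| + |(n : ℝ)| :=
    abs_le.mpr ⟨by linarith [abs_nonneg (m : ℝ)], by linarith [abs_nonneg (n : ℝ)]⟩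
  have hpos : ∀ {j : ℤ}, 1 ≤ j → |(j : ℝ)| = j ∧ (1 : ℝ) ≤ j := fun {j} h => by
    have : (1 : ℝ) ≤ j := by exact_mod_cast h
    exact ⟨abs_of_nonneg (by linarith), this⟩
  have hneg : ∀ {j : ℤ}, ¬ 1 ≤ j → |(j : ℝ)| = -j ∧ (j : ℝ) ≤ 0 := fun {j} h => by
    have : (j : ℝ) ≤ 0 := by exact_mod_cast (by omega : j ≤ 0)
    exact ⟨abs_of_nonpos this, this⟩
  unfold eigenvalue
  by_cases hm : 1 ≤ m <;> by_cases hn : 1 ≤ n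
  · rw [if_pos hm, if_pos hn, mul_comm |_|]
    rw [(hpos hm).1, (hpos hn).1] at *
    have h1 := (hpos hm).2
    have h2 := (hpos hn).2
    refine aux ?_ ?_
    · rcases abs_cases (1 - ((m : ℝ) + k) - (n + k)) with h | h <;> linarith
    · rcases abs_cases ((m : ℝ) + k - (n + k) - 1 / 2) with h | h <;>
        rcases abs_cases ((m : ℝ) - n) with h' | h' <;> linarith
  · rw [if_pos hm, if_neg hn]
    rw [(hpos hm).1, (hneg hn).1] at *
    have h1 := (hpos hm).2
    have h2 := (hneg hn).2
    refine aux ?_ ?_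
    · rcases abs_cases ((m : ℝ) + k - (n - k) - 1 / 2) with h | h <;> linarith
    · rcases abs_cases (1 - ((m : ℝ) + k) - (n - k)) with h | h <;>
        rcases abs_cases ((m : ℝ) - -n) with h' | h' <;> linarith
  · rw [if_neg hm, if_pos hn]
    rw [(hneg hm).1, (hpos hn).1] at *
    have h1 := (hneg hm).2
    have h2 := (hpos hn).2
    refine aux ?_ ?_
    · rcases abs_cases ((m : ℝ) - k - (n + k) - 1 / 2) with h | h <;> linarith
    · rcases abs_cases (1 - ((m : ℝ) - k) - (n + k)) with h | h <;>
        rcases abs_cases (-(m : ℝ) - n) with h' | h' <;> linarith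
  · rw [if_neg hm, if_neg hn, mul_comm |_|]
    rw [(hneg hm).1, (hneg hn).1] at *
    have h1 := (hneg hm).2
    have h2 := (hneg hn).2
    refine aux ?_ ?_
    · rcases abs_cases (1 - ((m : ℝ) - k) - (n - k)) with h | h <;> linarith
    · rcases abs_cases ((m : ℝ) - k - (n - k) - 1 / 2) with h | h <;>
        rcases abs_cases (-(m : ℝ) - -n) with h' | h' <;> linarith

theorem exists_rieszInt_bound {k : ℝ} (hk : 0 ≤ k) : ∃ C : ℝ, 0 < C ∧ ∀ n m : ℤ,
    ‖rieszInt k n m‖ * (1 + |(|(m : ℝ)| - |(n : ℝ)|)|) ≤ C := by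
  obtain ⟨A, hA, hP⟩ := exists_norm_hoProd_le hk
  obtain ⟨B, hB, hR⟩ := exists_rieszInt_mul_le hk
  have hpi := Real.pi_pos
  refine ⟨4 * Real.pi * A + 16 * B, by positivity, fun n m => ?_⟩
  have htriv : ‖rieszInt k n m‖ ≤ 2 * Real.pi * A := by
    have := intervalIntegral.norm_integral_le_of_norm_le_const (a := 0) (b := 2 * Real.pi) (C := A)
      (f := fun x : ℝ => Complex.exp (-(Complex.I * x / 2)) * hoProd k n m x) (fun x hx => by
        rw [Set.uIoc_of_le (by positivity)] at hx
        rw [norm_mul, show -(Complex.I * x / 2) = ((-(x / 2) : ℝ) : ℂ) * Complex.I by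
          push_cast; ring, Complex.norm_exp_ofReal_mul_I, one_mul]
        exact (hP n m x (Set.Ioc_subset_Icc_self hx)).1)
    rw [sub_zero, abs_of_pos (by positivity)] at this
    change ‖rieszInt k n m‖ ≤ _ at this
    linarith
  set d := |(|(m : ℝ)| - |(n : ℝ)|)| with hd
  have hd0 : 0 ≤ d := abs_nonneg _
  have hdint : d = ((|(|m| - |n|)| : ℤ) : ℝ) := by push_cast; rfl
  -- The distance is an integer: either it is at most `1` and the trivial bound suffices, or it is
  -- at least `2` and `eigenvalue_gap` applies.
  rcases le_or_gt (|(|m| - |n|)|) 1 with h1 | h1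
  · have : d ≤ 1 := by rw [hdint]; exact_mod_cast h1
    nlinarith [norm_nonneg (rieszInt k n m)]
  have hd2 : 2 ≤ d := by
    rw [hdint]
    have : 2 ≤ |(|m| - |n|)| := by omega
    exact_mod_cast this
  set N : ℝ := |(n : ℝ)| + |(m : ℝ)| + 2 with hN
  have hN0 : 0 < N := by positivity
  have hNd : d ≤ N - 2 := by
    rw [hd, hN]
    refine abs_le.mpr ⟨?_, ?_⟩ <;> linarith [abs_nonneg (n : ℝ), abs_nonneg (m : ℝ)]
  have key : N * d / 8 ≤ |eigenvalue k m - eigenvalue k n - 1 / 2|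
      * |1 - eigenvalue k m - eigenvalue k n| := by
    exact eigenvalue_gap hk hd2
  have h2 := hR n m
  have h3 : d * ‖rieszInt k n m‖ ≤ 8 * B := by
    refine le_of_mul_le_mul_left ?_ hN0
    have := mul_le_mul_of_nonneg_right key (norm_nonneg (rieszInt k n m))
    linarith
  nlinarith [norm_nonneg (rieszInt k n m)]

/-! ### The difference of consecutive Riesz integrals -/

/-- The matrix coefficients of the multiplication by `sin (x / 2)`. -/
noncomputable def sinHalfInt (k : ℝ) (n m : ℤ) : ℂ :=
  ∫ x in (0 : ℝ)..(2 * Real.pi), (Real.sin (x / 2) : ℂ) * hoProd k n m x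

theorem intervalIntegrable_mul_hoProd {k : ℝ} (hk : 0 ≤ k) (n m : ℤ) {f : ℝ → ℂ}
    (hf : Continuous f) : IntervalIntegrable (fun x => f x * hoProd k n m x)
      MeasureTheory.volume 0 (2 * Real.pi) := by
  have := continuous_hoProd hk n m
  exact Continuous.intervalIntegrable (by fun_prop) _ _

/-- Since `sin(x/2)` is symmetric about `π`, no singular term appears. Writing its derivative as
`(e^{-ix/2} + i sin(x/2)) / 2` produces the Riesz integral and shifts the spectral gap by `1/2`. -/
theorem norm_sinHalfInt_mul {k : ℝ} (hk : 0 ≤ k) (n m : ℤ) :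
    |eigenvalue k m - eigenvalue k n + 1 / 2| * ‖sinHalfInt k n m‖ = ‖rieszInt k n m‖ / 2 := by
  have key := (cherednikEigen_hoFun hk m).integral_by_parts_of_symm hk
    (cherednikEigen_hoFun hk n) (φ := fun x : ℝ => (Real.sin (x / 2) : ℂ))
    (φ' := fun x : ℝ => ((Real.cos (x / 2) / 2 : ℝ) : ℂ))
    (Continuous.continuousOn (by fun_prop)) (fun x _ => (hasDerivAt_sin_half x).ofReal_comp)
    (Continuous.continuousOn (by fun_prop)) (fun x => by
      rw [show (2 * Real.pi - x) / 2 = Real.pi - x / 2 by ring, Real.sin_pi_sub])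
  change (∫ x in (0 : ℝ)..(2 * Real.pi), ((Real.cos (x / 2) / 2 : ℝ) : ℂ) * hoProd k n m x)
    + _ * sinHalfInt k n m = 0 at key
  have h1 : ∫ x in (0 : ℝ)..(2 * Real.pi), ((Real.cos (x / 2) / 2 : ℝ) : ℂ) * hoProd k n m x
      = 1 / 2 * rieszInt k n m + Complex.I / 2 * sinHalfInt k n m := by
    unfold rieszInt sinHalfInt
    rw [← intervalIntegral.integral_const_mul, ← intervalIntegral.integral_const_mul,
      ← intervalIntegral.integral_add
        ((intervalIntegrable_mul_hoProd hk n m (by fun_prop)).const_mul _)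
        ((intervalIntegrable_mul_hoProd hk n m (by fun_prop)).const_mul _)]
    refine intervalIntegral.integral_congr fun x _ => ?_
    simp only [exp_neg_half_eq]
    push_cast
    ring
  rw [h1] at key
  have h2 : Complex.I * ((eigenvalue k m - eigenvalue k n + 1 / 2 : ℝ) : ℂ) * sinHalfInt k n m
      = -(1 / 2 * rieszInt k n m) := by
    push_cast
    linear_combination key
  have h3 := congrArg norm h2
  rw [norm_mul, norm_mul, Complex.norm_I, one_mul, Complex.norm_real, Real.norm_eq_abs, norm_neg,
    norm_mul] at h3
  rw [h3]
  norm_num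
  ring

theorem half_abs_sub_abs_le_eigenvalue {k : ℝ} (hk : 0 ≤ k) {n m : ℤ}
    (hd : 1 ≤ |(|(m : ℝ)| - |(n : ℝ)|)|) :
    |(|(m : ℝ)| - |(n : ℝ)|)| / 2 ≤ |eigenvalue k m - eigenvalue k n + 1 / 2| := by
  have h1 : |(|(m : ℝ)| - |(n : ℝ)|)| ≤ |(m : ℝ) - n| := abs_abs_sub_abs_le _ _
  have h2 : |(m : ℝ) - n| ≤ |eigenvalue k m - eigenvalue k n| := by
    unfold eigenvalue
    split_ifs with hm hn hn
    · exact le_of_eq (by ring_nf)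
    · have : (n : ℝ) ≤ m := by exact_mod_cast (by omega : n ≤ m)
      rw [abs_of_nonneg (by linarith), abs_of_nonneg (by linarith)]
      linarith
    · have : (m : ℝ) ≤ n := by exact_mod_cast (by omega : m ≤ n)
      rw [abs_of_nonpos (by linarith), abs_of_nonpos (by linarith)]
      linarith
    · exact le_of_eq (by ring_nf)
  have h3 : |eigenvalue k m - eigenvalue k n| ≤
      |eigenvalue k m - eigenvalue k n + 1 / 2| + |(1 / 2 : ℝ)| := by
    have := abs_sub (eigenvalue k m - eigenvalue k n + 1 / 2) (1 / 2)
    rwa [add_sub_cancel_right] at this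
  rw [abs_of_pos (by norm_num : (0 : ℝ) < 1 / 2)] at h3
  linarith

/-- The shift by `e^{ix}` is exchanged between the polynomial and the kernel: `e^{-ix/2} e^{ix} =
e^{-ix/2} + 2i sin(x/2)`. -/
theorem rieszInt_add_one_sub {k : ℝ} (hk : 0 ≤ k) (n m : ℤ) {u v : ℂ} {p q : ℤ}
    (h : ∀ x, hoFun k (m + 1) x - Complex.exp (Complex.I * x) * hoFun k m x
      = u * hoFun k p x + v * hoFun k q x) :
    rieszInt k n (m + 1) - rieszInt k n m = u * rieszInt k n p + v * rieszInt k n q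
      + 2 * Complex.I * sinHalfInt k n m := by
  have hi : ∀ j, IntervalIntegrable (fun x : ℝ => Complex.exp (-(Complex.I * x / 2))
      * hoProd k n j x) MeasureTheory.volume 0 (2 * Real.pi) := fun j =>
    intervalIntegrable_mul_hoProd hk n j (by fun_prop)
  have hs : IntervalIntegrable (fun x : ℝ => (Real.sin (x / 2) : ℂ) * hoProd k n m x)
      MeasureTheory.volume 0 (2 * Real.pi) := intervalIntegrable_mul_hoProd hk n m (by fun_prop)
  unfold rieszInt sinHalfInt
  rw [← intervalIntegral.integral_sub (hi _) (hi _), ← intervalIntegral.integral_const_mul,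
    ← intervalIntegral.integral_const_mul, ← intervalIntegral.integral_const_mul,
    ← intervalIntegral.integral_add ((hi p).const_mul u) ((hi q).const_mul v),
    ← intervalIntegral.integral_add (((hi p).const_mul u).add ((hi q).const_mul v))
      (hs.const_mul _)]
  refine intervalIntegral.integral_congr fun x _ => ?_
  have he : Complex.exp (-(Complex.I * x / 2)) * Complex.exp (Complex.I * x)
      = Complex.exp (-(Complex.I * x / 2)) + 2 * Complex.I * (Real.sin (x / 2) : ℂ) := by
    rw [← Complex.exp_add, show -(Complex.I * x / 2) + Complex.I * x
      = -(Complex.I * (-x : ℝ) / 2) by push_cast; ring, exp_neg_half_eq, exp_neg_half_eq,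
      neg_div, Real.cos_neg, Real.sin_neg]
    push_cast
    ring
  simp only [hoProd]
  set e := Complex.exp (-(Complex.I * x / 2))
  linear_combination (e * (starRingEnd ℂ) (hoFun k n x) * weight k x) * h x
    + (hoFun k m x * (starRingEnd ℂ) (hoFun k n x) * weight k x) * he

theorem norm_rieszInt_add_one_sub_le {k : ℝ} (hk : 0 ≤ k) (n : ℤ) {m : ℤ} (hm : m ≠ 0) :
    ‖rieszInt k n (m + 1) - rieszInt k n m‖ ≤ (k / |(m : ℝ)|) ^ 2 * ‖rieszInt k n (m + 1)‖
      + k / |(m : ℝ)| * ‖rieszInt k n (1 - m)‖ + 2 * ‖sinHalfInt k n m‖ := by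
  obtain ⟨l, hl⟩ : ∃ l : ℕ, |m| = l + 1 := ⟨(|m| - 1).toNat, by have := abs_pos.mpr hm; omega⟩
  have hlr : |(m : ℝ)| = (l : ℝ) + 1 := by exact_mod_cast hl
  set β := recCoeff k (l + 1) with hβ
  set γ := recCoeff' k (l + 1) with hγ
  have hγ2 : γ ^ 2 = 1 - β ^ 2 := recCoeff'_sq hk l
  have hγ0 : 0 < γ := recCoeff'_pos hk l
  have hβ0 : 0 ≤ β := recCoeff_nonneg hk _
  have hβk : β ≤ k / |(m : ℝ)| := by
    rw [hlr, hβ, recCoeff]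
    push_cast
    exact div_le_div_of_nonneg_left hk (by positivity) (by linarith)
  have hγ1 : |1 - γ| ≤ (k / |(m : ℝ)|) ^ 2 := by
    -- From `0 < γ ≤ 1` follows `γ ≥ γ² = 1 - β²`, so `1 - γ` is of second order in `β`.
    have h1 : γ ≤ 1 := by nlinarith
    rw [abs_of_nonneg (by linarith)]
    have h2 : 1 - γ ≤ β ^ 2 := by nlinarith
    exact h2.trans (by gcongr)
  have key : ∃ v : ℝ, |v| = β ∧ rieszInt k n (m + 1) - rieszInt k n m
      = ((1 - γ : ℝ) : ℂ) * rieszInt k n (m + 1) + (v : ℂ) * rieszInt k n (1 - m)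
        + 2 * Complex.I * sinHalfInt k n m := by
    rcases abs_choice m with hc | hc
    · have hml : m = l + 1 := by omega
      subst hml
      refine ⟨β, abs_of_nonneg hβ0, rieszInt_add_one_sub hk _ _ fun x => ?_⟩
      rw [exp_mul_hoFun_add_one hk, show (1 : ℤ) - (l + 1) = -l by ring]
      push_cast
      ring
    · have hml : m = -(l + 1 : ℕ) := by push_cast; omega
      subst hml
      refine ⟨-β, by rw [abs_neg, abs_of_nonneg hβ0], rieszInt_add_one_sub hk _ _ fun x => ?_⟩
      rw [exp_mul_hoFun_neg hk, show (1 : ℤ) - -(l + 1 : ℕ) = l + 1 + 1 by push_cast; ring,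
        show -((l + 1 : ℕ) : ℤ) + 1 = -l by push_cast; ring]
      push_cast
      ring
  obtain ⟨v, hv, h⟩ := key
  rw [h]
  refine (norm_add_le _ _).trans (add_le_add ((norm_add_le _ _).trans (add_le_add ?_ ?_)) ?_)
  · rw [norm_mul, Complex.norm_real, Real.norm_eq_abs]
    gcongr
  · rw [norm_mul, Complex.norm_real, Real.norm_eq_abs, hv]
    gcongr
  · simp

theorem exists_rieszInt_sub_bound {k : ℝ} (hk : 0 ≤ k) : ∃ C : ℝ, 0 < C ∧ ∀ n m : ℤ,
    |(n : ℝ)| / 2 ≤ |(m : ℝ)| → |(m : ℝ)| ≤ 3 * |(n : ℝ)| / 2 → |m| ≠ |n| →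
      ‖rieszInt k n (m + 1) - rieszInt k n m‖ ≤ C / (|(m : ℝ)| - |(n : ℝ)|) ^ 2 := by
  obtain ⟨C, hC, hR⟩ := exists_rieszInt_bound hk
  -- The summands `k²`, `k` and `2` come from the terms with `𝓔_{m+1}`, `𝓔_{1-m}` and `sin(x/2)`.
  refine ⟨(k ^ 2 + k + 2) * C, by positivity, fun n m h1 h2 hne => ?_⟩
  have hm : m ≠ 0 := by
    rintro rfl
    apply hne
    have h3 : |(n : ℝ)| = 0 := by
      rw [Int.cast_zero, abs_zero] at h1
      linarith [abs_nonneg (n : ℝ)]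
    have h4 : n = 0 := by exact_mod_cast abs_eq_zero.mp h3
    rw [h4]
  rw [← sq_abs (|(m : ℝ)| - |(n : ℝ)|)]
  set d := |(|(m : ℝ)| - |(n : ℝ)|)| with hd
  have hd1 : 1 ≤ d := by
    have h3 : 1 ≤ |(|m| - |n|)| := Int.one_le_abs (sub_ne_zero.mpr hne)
    have h4 : (1 : ℝ) ≤ ((|(|m| - |n|)| : ℤ) : ℝ) := by exact_mod_cast h3
    push_cast at h4
    exact h4
  have hd0 : 0 < d := by linarith
  -- Comparability of `|m|` and `|n|` enters here: it converts the gain `1 / |m|` from the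
  -- recurrence into `1 / d`.
  have hdm : d ≤ |(m : ℝ)| := abs_le.mpr ⟨by linarith, by linarith⟩
  have b1 : ‖rieszInt k n (m + 1)‖ ≤ C := by
    have := hR n (m + 1)
    nlinarith [norm_nonneg (rieszInt k n (m + 1)),
      abs_nonneg (|((m + 1 : ℤ) : ℝ)| - |(n : ℝ)|)]
  have b2 : ‖rieszInt k n (1 - m)‖ ≤ C / d := by
    rw [le_div_iff₀ hd0]
    -- The moduli of `m` and `1 - m` differ by at most one, which the `1 +` in the decay bound
    -- absorbs.
    refine le_trans (mul_le_mul_of_nonneg_left ?_ (norm_nonneg _)) (hR n (1 - m))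
    have h3 : |((1 - m : ℤ) : ℝ)| ≤ |(m : ℝ)| + 1 := by
      push_cast
      have := abs_sub (1 : ℝ) m
      rw [abs_one] at this
      linarith
    have h4 : |(m : ℝ)| ≤ |((1 - m : ℤ) : ℝ)| + 1 := by
      push_cast
      have := abs_sub (1 : ℝ) (1 - m)
      rw [abs_one, sub_sub_cancel] at this
      linarith
    rw [hd]
    rcases abs_cases (|(m : ℝ)| - |(n : ℝ)|) with h | h <;>
      rcases abs_cases (|((1 - m : ℤ) : ℝ)| - |(n : ℝ)|) with h' | h' <;> linarith
  have b3 : ‖sinHalfInt k n m‖ ≤ C / d ^ 2 := by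
    rw [le_div_iff₀ (by positivity)]
    have h3 := norm_sinHalfInt_mul hk n m
    have h4 : d / 2 * ‖sinHalfInt k n m‖ ≤ ‖rieszInt k n m‖ / 2 := by
      rw [← h3]
      gcongr
      exact half_abs_sub_abs_le_eigenvalue hk hd1
    have h5 := hR n m
    rw [← hd] at h5
    nlinarith [norm_nonneg (rieszInt k n m)]
  have hkm : k / |(m : ℝ)| ≤ k / d := by gcongr
  refine (norm_rieszInt_add_one_sub_le hk n hm).trans ?_
  calc _ ≤ (k / d) ^ 2 * C + k / d * (C / d) + 2 * (C / d ^ 2) := by gcongr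
    _ = _ := by field_simp

end HeckmanOpdam

theorem mainTheorem4 (k : ℝ) (hk : 0 ≤ k) :
    ∃ C : ℝ, 0 < C ∧ ∀ n m : ℤ,
      |(n : ℝ)| / 2 ≤ |(m : ℝ)| → |(m : ℝ)| ≤ 3 * |(n : ℝ)| / 2 → |m| ≠ |n| →
        ‖HeckmanOpdam.rieszKernel k n (m + 1) - HeckmanOpdam.rieszKernel k n m‖
          ≤ C / (|(m : ℝ)| - |(n : ℝ)|) ^ 2 := by
  obtain ⟨C, hC, h⟩ := HeckmanOpdam.exists_rieszInt_sub_bound hk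
  refine ⟨C, hC, fun n m h1 h2 hne => le_trans ?_ (h n m h1 h2 hne)⟩
  rw [HeckmanOpdam.rieszKernel_eq hk, HeckmanOpdam.rieszKernel_eq hk, ← mul_sub, norm_mul]
  -- The prefactor of the kernel has modulus `1 / (2π) ≤ 1`, so the constant is unchanged.
  refine mul_le_of_le_one_left (norm_nonneg _) ?_
  rw [norm_div, norm_mul, norm_mul, Complex.norm_I, norm_one, Complex.norm_ofNat,
    Complex.norm_real, Real.norm_of_nonneg Real.pi_pos.le, mul_one,
    div_le_one (by positivity)]
  linarith [Real.two_le_pi]
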